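/- **Setting.** Let $\mathcal Y,\mathcal X$ be finite sets, $\kappa:\mathcal Y\to\mathcal X$ a surjection, $\mathcal S_x=\kappa^{-1}(x)$, $\mathcal E\subset\mathcal Y^2$, and $\mathcal D=\{(\kappa(y),\kappa(y')):(y,y')\in\mathcal E\}$. Let $\mathcal W(\mathcal Y,\mathcal E)$ be the set of irreducible row-stochastic matrices $P$ on $\mathcal Y$ with $P(y,y')>0\iff(y,y')\in\mathcal E$, and let $\mathcal W_\kappa(\mathcal Y,\mathcal E)$ be the set of those that are $\kappa$-lumpable: for every initial distribution the process $\kappa(Y_t)$ is a time-homogeneous Markov chain, with transition matrix independent of the initial distribution. For a matrix $F$ with $F(y,y')>0$ for $(y,y')\in\mathcal E$ and $F(y,y')=0$ otherwise ($(\mathcal Y,\mathcal E)$ strongly connected), put $\mathfrak s(F)(y,y')=F(y,y')v_F(y')/(\rho_Fv_F(y))$, where $\rho_F$ is the Perron–Frobenius root and $v_F>0$ the associated right eigenvector. Let $\mathcal N\subset\mathbb R^{\mathcal E}$ be the space of functions $(y,y')\mapsto f(y')-f(y)+c$ with $f\in\mathbb R^{\mathcal Y}$, $c\in\mathbb R$.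 A set $\mathcal V\subset\mathcal W(\mathcal Y,\mathcal E)$ *forms an e-family* if there are $d\ge 0$, $K\in\mathbb R^{\mathcal E}$ and $G_1,\dots,G_d\in\mathbb R^{\mathcal E}$, linearly independent modulo $\mathcal N$, with $\mathcal V=\{\mathfrak s(\exp(K+\sum_i\theta^iG_i)):\theta\in\mathbb R^d\}$ (entrywise exponential on $\mathcal E$, zero off $\mathcal E$). The map $\kappa$ is *degenerate* if $|\mathcal X|\in\{1,|\mathcal Y|\}$. Families $\mathcal W_{\kappa_1}(\mathcal Y_1,\mathcal E_1)$ and $\mathcal W_{\kappa_2}(\mathcal Y_2,\mathcal E_2)$ are *equivalent* if there are bijections $\phi:\mathcal Y_1\to\mathcal Y_2$ and $\psi:\mathcal X_1\to\mathcal X_2$ with $\psi\circ\kappa_1=\kappa_2\circ\phi$ that carry $\mathcal E_1$ onto $\mathcal E_2$ and $\mathcal D_1$ onto $\mathcal D_2$. Let $\mathcal G_\kappa\subset\mathbb R^{\mathcal E}$ be the set of $\log F$, where $F:\mathcal E\to(0,\infty)$ is such that for every $(x,x')\in\mathcal D$ the sum $\sum_{y'\in\mathcal S_{x'},\,(y,y')\in\mathcal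 E}F(y,y')$ is the same for all $y\in\mathcal S_x$. The *dimensional criterion* is the equation $$\dim(\operatorname{span}\mathcal G_\kappa+\mathcal N)=|\mathcal E|+|\mathcal Y|+|\mathcal D|-|\mathcal X|-\sum_{(x,x')\in\mathcal D}|\mathcal S_x| .$$ Patterns on $\mathcal Y=\{0,1,2\}$, lumped into the classes $\{0\},\{1,2\}$, are written row by row, $+$ marking an edge. **Theorem.** Let $|\mathcal Y|=3$ and $\mathcal W_\kappa(\mathcal Y,\mathcal E)\neq\emptyset$. 1. $\mathcal W_\kappa(\mathcal Y,\mathcal E)$ forms an e-family if and only if $\kappa$ is degenerate or $\mathcal W_\kappa(\mathcal Y,\mathcal E)$ is equivalent to one of the 12 families $(0{+}{+}\,|\,{+}00\,|\,{+}00)$, $({+}{+}{+}\,|\,{+}00\,|\,{+}00)$, $(00{+}\,|\,{+}0{+}\,|\,{+}{+}0)$, $(00{+}\,|\,{+}{+}0\,|\,{+}{+}0)$, $({+}0{+}\,|\,{+}{+}0\,|\,{+}{+}0)$, $(0{+}{+}\,|\,{+}{+}0\,|\,{+}{+}0)$, $({+}0{+}\,|\,{+}0{+}\,|\,{+}{+}0)$,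 $({+}{+}{+}\,|\,{+}{+}0\,|\,{+}{+}0)$, $(0{+}{+}\,|\,{+}0{+}\,|\,{+}{+}0)$, $({+}{+}{+}\,|\,{+}0{+}\,|\,{+}{+}0)$, $(0{+}{+}\,|\,{+}{+}0\,|\,{+}0{+})$, $({+}{+}{+}\,|\,{+}{+}0\,|\,{+}0{+})$. 2. If $\kappa$ is non-degenerate and $\mathcal W_\kappa(\mathcal Y,\mathcal E)$ is equivalent to none of these, then the dimensional criterion fails for it, and it is equivalent to one of the 14 families $(a\,|\,{+}{+}{+}\,|\,{+}{+}0)$ with $a\in\{0{+}0,\ {+}{+}0,\ 00{+},\ {+}0{+},\ 0{+}{+},\ {+}{+}{+}\}$; $\ (a\,|\,{+}{+}{+}\,|\,{+}0{+})$ with $a\in\{0{+}0,\ {+}{+}0,\ 0{+}{+},\ {+}{+}{+}\}$; $\ (a\,|\,{+}{+}{+}\,|\,{+}{+}{+})$ with $a\in\{00{+},\ {+}0{+},\ 0{+}{+},\ {+}{+}{+}\}$. 3. The 12 families and the 14 families are all non-empty, and the 26 of them are pairwise inequivalent. -/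

import Mathlib

open scoped Matrix

noncomputable section

/-- The lumped edge set `D = κ(E)`. -/
def lumpedEdges {Y X : Type*} [DecidableEq X] (κ : Y → X) (E : Finset (Y × Y)) :
    Finset (X × X) :=
  E.image fun e => (κ e.1, κ e.2)

/-- `W(Y, E)`: irreducible row-stochastic matrices whose connection graph is `(Y, E)`. -/
def stochasticFamily {Y : Type*} [Fintype Y] [DecidableEq Y] (E : Finset (Y × Y)) :
    Set (Matrix Y Y ℝ) :=
  {P | P ∈ Matrix.rowStochastic ℝ Y ∧ P.IsIrreducible ∧ ∀ y y', 0 < P y y' ↔ (y, y') ∈ E}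

/-- The probability that the lumped process visits `x 0, …, x n` at times `0, …, n`, when the
chain with transition matrix `P` is started from the distribution `μ`. -/
def lumpedPathProb {Y X : Type*} [Fintype Y] [DecidableEq X] (μ : Y → ℝ) (P : Matrix Y Y ℝ)
    (κ : Y → X) (n : ℕ) (x : Fin (n + 1) → X) : ℝ :=
  ∑ y : Fin (n + 1) → Y with ∀ i, κ (y i) = x i,
    μ (y 0) * ∏ i : Fin n, P (y i.castSucc) (y i.succ)

/-- `P` is `κ`-lumpable: whatever the initial distribution, the lumped process is a
time-homogeneous Markov chain, with one and the same transition matrix `Q`. -/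
def IsLumpable {Y X : Type*} [Fintype Y] [Fintype X] [DecidableEq X]
    (κ : Y → X) (P : Matrix Y Y ℝ) : Prop :=
  ∃ Q ∈ Matrix.rowStochastic ℝ X, ∀ μ ∈ stdSimplex ℝ Y, ∀ (n : ℕ) (x : Fin (n + 2) → X),
    lumpedPathProb μ P κ (n + 1) x =
      lumpedPathProb μ P κ n (fun i => x i.castSucc) *
        Q (x (Fin.last n).castSucc) (x (Fin.last (n + 1)))

/-- `W_κ(Y, E)`: the `κ`-lumpable members of `W(Y, E)`. -/
def lumpableFamily {Y X : Type*} [Fintype Y] [DecidableEq Y] [Fintype X] [DecidableEq X]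
    (κ : Y → X) (E : Finset (Y × Y)) : Set (Matrix Y Y ℝ) :=
  {P | P ∈ stochasticFamily E ∧ IsLumpable κ P}

/-- A function on the edge set, seen as a matrix vanishing off the edge set. -/
def edgeMatrix {Y : Type*} [DecidableEq Y] {E : Finset (Y × Y)} (F : E → ℝ) : Matrix Y Y ℝ :=
  Matrix.of fun y y' => if h : (y, y') ∈ E then F ⟨(y, y'), h⟩ else 0

/-- The Perron-Frobenius root of a nonnegative matrix: its spectral radius. -/
def perronRoot {Y : Type*} [Fintype Y] [DecidableEq Y] (F : Matrix Y Y ℝ) : ℝ :=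
  (spectralRadius ℂ (F.map (fun r : ℝ => (r : ℂ)))).toReal

open Classical in
/-- A positive right eigenvector for the Perron-Frobenius root. It exists, and is unique up to
scaling, for every irreducible nonnegative matrix. -/
def perronVector {Y : Type*} [Fintype Y] [DecidableEq Y] (F : Matrix Y Y ℝ) : Y → ℝ :=
  if h : ∃ v : Y → ℝ, (∀ y, 0 < v y) ∧ F *ᵥ v = perronRoot F • v then h.choose else 0

/-- The normalization of an irreducible nonnegative matrix into a stochastic matrix. -/
def sNormalization {Y : Type*} [Fintype Y] [DecidableEq Y] (F : Matrix Y Y ℝ) : Matrix Y Y ℝ :=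
  Matrix.of fun y y' => F y y' * perronVector F y' / (perronRoot F * perronVector F y)

/-- `N(Y, E)`: the edge functions of the form `f y' - f y + c`. -/
def antiShift {Y : Type*} (E : Finset (Y × Y)) : Submodule ℝ (E → ℝ) where
  carrier := {N | ∃ (c : ℝ) (f : Y → ℝ), ∀ e : E, N e = f e.1.2 - f e.1.1 + c}
  zero_mem' := ⟨0, 0, fun e => by simp⟩
  add_mem' := by
    rintro _ _ ⟨c, f, hf⟩ ⟨c', f', hf'⟩
    exact ⟨c + c', f + f', fun e => by simp only [Pi.add_apply, hf, hf']; ring⟩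
  smul_mem' := by
    rintro a _ ⟨c, f, hf⟩
    exact ⟨a * c, a • f, fun e => by simp only [Pi.smul_apply, smul_eq_mul, hf]; ring⟩

/-- `V` is an exponential family of stochastic matrices over `(Y, E)`, of some dimension `d`:
`V = {s(exp(K + ∑ θ i • G i)) : θ ∈ ℝ^d}` with `G 0, …, G (d - 1)` linearly independent
modulo `N(Y, E)`. -/
def IsEFamily {Y : Type*} [Fintype Y] [DecidableEq Y] (E : Finset (Y × Y))
    (V : Set (Matrix Y Y ℝ)) : Prop :=
  V ⊆ stochasticFamily E ∧
  ∃ (d : ℕ) (K : E → ℝ) (G : Fin d → E → ℝ),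
    LinearIndependent ℝ (fun i => (antiShift E).mkQ (G i)) ∧
    V = Set.range fun θ : Fin d → ℝ =>
      sNormalization (edgeMatrix fun e : E => Real.exp (K e + ∑ i, θ i * G i e))

/-- `κ : Y → X` is degenerate when `|X| ∈ {1, |Y|}`. -/
def IsDegenerate {Y X : Type*} [Fintype Y] [Fintype X] (_κ : Y → X) : Prop :=
  Fintype.card X = 1 ∨ Fintype.card X = Fintype.card Y

/-- Equivalence of lumpable families: they coincide upon relabeling of the state space and of
the lumped state space. -/
def FamilyEquiv {Y₁ X₁ Y₂ X₂ : Type*} [DecidableEq X₁] [DecidableEq X₂]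
    (κ₁ : Y₁ → X₁) (E₁ : Finset (Y₁ × Y₁)) (κ₂ : Y₂ → X₂) (E₂ : Finset (Y₂ × Y₂)) : Prop :=
  ∃ (φ : Y₁ ≃ Y₂) (ψ : X₁ ≃ X₂),
    (∀ y y', (φ y, φ y') ∈ E₂ ↔ (y, y') ∈ E₁) ∧
    (∀ x x', (ψ x, ψ x') ∈ lumpedEdges κ₂ E₂ ↔ (x, x') ∈ lumpedEdges κ₁ E₁) ∧
    ∀ y, ψ (κ₁ y) = κ₂ (φ y)

/-- `G_κ(Y, E)`: the entrywise logarithms of the positive `κ`-lumpable functions on `E`. -/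
def logLumpableCone {Y X : Type*} [Fintype Y] [DecidableEq Y] [DecidableEq X]
    (κ : Y → X) (E : Finset (Y × Y)) : Set (E → ℝ) :=
  {g | ∃ F : E → ℝ, (∀ e, 0 < F e) ∧
    (∀ p ∈ lumpedEdges κ E, ∀ y₁ y₂, κ y₁ = p.1 → κ y₂ = p.1 →
      ∑ y' with κ y' = p.2, edgeMatrix F y₁ y' = ∑ y' with κ y' = p.2, edgeMatrix F y₂ y') ∧
    ∀ e, g e = Real.log (F e)}

/-- The dimensional criterion:
`dim (span G_κ(Y, E) + N(Y, E)) = |E| + |Y| + |D| - |X| - ∑ (x, x') ∈ D, |κ⁻¹(x)|`. -/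
def DimensionalCriterion {Y X : Type*} [Fintype Y] [DecidableEq Y] [Fintype X] [DecidableEq X]
    (κ : Y → X) (E : Finset (Y × Y)) : Prop :=
  (Module.finrank ℝ ↥(Submodule.span ℝ (logLumpableCone κ E) ⊔ antiShift E) : ℤ) =
    (E.card : ℤ) + Fintype.card Y + (lumpedEdges κ E).card - Fintype.card X
      - ∑ p ∈ lumpedEdges κ E, ((Finset.univ.filter fun y => κ y = p.1).card : ℤ)

/-- The lumping of three states with classes `{0}` and `{1, 2}`. -/
def threeLump : Fin 3 → Fin 2 := ![0, 1, 1]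

/-- The edge set on three states with the given adjacency matrix. -/
def edgesOf (A : Matrix (Fin 3) (Fin 3) ℕ) : Finset (Fin 3 × Fin 3) :=
  Finset.univ.filter fun e => A e.1 e.2 = 1

/-- The twelve listed families. -/
def listedPattern : Fin 12 → Finset (Fin 3 × Fin 3) :=
  ![edgesOf !![0, 1, 1; 1, 0, 0; 1, 0, 0],
    edgesOf !![1, 1, 1; 1, 0, 0; 1, 0, 0],
    edgesOf !![0, 0, 1; 1, 0, 1; 1, 1, 0],
    edgesOf !![0, 0, 1; 1, 1, 0; 1, 1, 0],
    edgesOf !![1, 0, 1; 1, 1, 0; 1, 1, 0],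
    edgesOf !![0, 1, 1; 1, 1, 0; 1, 1, 0],
    edgesOf !![1, 0, 1; 1, 0, 1; 1, 1, 0],
    edgesOf !![1, 1, 1; 1, 1, 0; 1, 1, 0],
    edgesOf !![0, 1, 1; 1, 0, 1; 1, 1, 0],
    edgesOf !![1, 1, 1; 1, 0, 1; 1, 1, 0],
    edgesOf !![0, 1, 1; 1, 1, 0; 1, 0, 1],
    edgesOf !![1, 1, 1; 1, 1, 0; 1, 0, 1]]

/-- Representatives of the fourteen other classes of non-degenerate non-empty families. -/
def otherPattern : Fin 14 → Finset (Fin 3 × Fin 3) :=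
  ![edgesOf !![0, 1, 0; 1, 1, 1; 1, 1, 0],
    edgesOf !![1, 1, 0; 1, 1, 1; 1, 1, 0],
    edgesOf !![0, 0, 1; 1, 1, 1; 1, 1, 0],
    edgesOf !![1, 0, 1; 1, 1, 1; 1, 1, 0],
    edgesOf !![0, 1, 1; 1, 1, 1; 1, 1, 0],
    edgesOf !![1, 1, 1; 1, 1, 1; 1, 1, 0],
    edgesOf !![0, 1, 0; 1, 1, 1; 1, 0, 1],
    edgesOf !![1, 1, 0; 1, 1, 1; 1, 0, 1],
    edgesOf !![0, 1, 1; 1, 1, 1; 1, 0, 1],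
    edgesOf !![1, 1, 1; 1, 1, 1; 1, 0, 1],
    edgesOf !![0, 0, 1; 1, 1, 1; 1, 1, 1],
    edgesOf !![1, 0, 1; 1, 1, 1; 1, 1, 1],
    edgesOf !![0, 1, 1; 1, 1, 1; 1, 1, 1],
    edgesOf !![1, 1, 1; 1, 1, 1; 1, 1, 1]]

end

/-! By Perron–Frobenius, `g ↦ s(exp g)` maps `ℝ^E` onto `W(Y, E)`, with the cosets of `N` as fibres
(`expNormalization_logOn`, `expNormalization_eq_iff`). An e-family is thus the image of an affine
subspace, and the lumpable family is the image of `G_κ + N`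
(`expNormalization_mem_lumpableFamily_iff`). What has to be decided is whether the latter is affine.

If each state sharing its block with another has at most one edge into each block, every block sum
involved has a single term. Lumpability is then linear in `log F`, and the family is an e-family
(`isEFamily_of_hasSingleEdges`). This covers the twelve listed patterns and bijective `κ`; for a
single block every stochastic matrix is lumpable.

In each of the fourteen other patterns some state `y₁` of the two-state block `{y₁, y₂}` has edges
to both states of that block. The constraint then reads `exp a + exp b = rowSum`, which affine
extrapolation in the logarithms violates (`IsWideBlock.not_isEFamily`). It is curved enough that
`span G_κ + N` is all of `ℝ^E`, of dimension `|E|`, while the criterion asks for `|E| - 1`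
(`IsWideBlock.not_dimensionalCriterion`).

That the twenty-six patterns exhaust the non-degenerate case and are inequivalent is a finite check
over nine adjacency bits. -/

noncomputable section

/-! ### Perron–Frobenius theory for irreducible nonnegative matrices -/

namespace Matrix

variable {n : Type*}

theorem isIrreducible_iff_transGen {M : Matrix n n ℝ} (hM : ∀ i j, 0 ≤ M i j) :
    M.IsIrreducible ↔ ∀ i j, Relation.TransGen (fun a b => 0 < M a b) i j := by
  constructor
  · rintro ⟨-, h⟩ i j
    let : Quiver n := toQuiver M
    obtain ⟨p, hp⟩ := h i j
    induction p with
    | nil => simp at hp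
    | @cons b c q e ih =>
      rcases Nat.eq_zero_or_pos q.length with h0 | h0
      · obtain rfl := Quiver.Path.eq_of_length_zero q h0
        exact .single e.down
      · exact (ih h0).tail e.down
  · intro h
    refine ⟨hM, fun i j => ?_⟩
    let : Quiver n := toQuiver M
    induction h i j with
    | single h => exact ⟨Quiver.Hom.toPath (PLift.up h), by simp⟩
    | tail _ h ih =>
      obtain ⟨p, hp⟩ := ih
      exact ⟨p.cons (PLift.up h), by simp⟩

variable [Fintype n]

theorem mulVec_pos_of_pos {B : Matrix n n ℝ} (hB : ∀ i j, 0 < B i j) {y : n → ℝ}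
    (hy : ∀ i, 0 ≤ y i) (hy0 : y ≠ 0) (i : n) : 0 < (B *ᵥ y) i := by
  obtain ⟨j, hj⟩ := Function.ne_iff.1 hy0
  exact Finset.sum_pos' (fun a _ => mul_nonneg (hB i a).le (hy a))
    ⟨j, Finset.mem_univ _, mul_pos (hB i j) ((hy j).lt_of_ne' hj)⟩

variable [DecidableEq n]

/-- An irreducible matrix commutes with a polynomial in it whose entries are all positive. -/
theorem IsIrreducible.exists_commute_pos {M : Matrix n n ℝ} (hM : M.IsIrreducible) :
    ∃ B : Matrix n n ℝ, (∀ i j, 0 < B i j) ∧ Commute B M ∧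
      ∀ (l : ℝ) (v : n → ℝ), M *ᵥ v = l • v → ∃ m : ℝ, B *ᵥ v = m • v := by
  choose k _ hk using (isIrreducible_iff_exists_pow_pos hM.nonneg).1 hM
  -- One power per pair of indices: `M` may be periodic, so no single power need be positive.
  refine ⟨∑ p : n × n, M ^ k p.1 p.2, fun i j => ?_, ?_, fun l v hv => ?_⟩
  · rw [Matrix.sum_apply]
    exact Finset.sum_pos' (fun p _ => pow_apply_nonneg hM.nonneg _ _ _)
      ⟨(i, j), Finset.mem_univ _, hk i j⟩
  · exact Commute.sum_left _ _ _ fun p _ => (Commute.refl M).pow_left _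
  · have hp : ∀ r : ℕ, (M ^ r) *ᵥ v = l ^ r • v := by
      intro r
      induction r with
      | zero => simp
      | succ r ih => rw [pow_succ, ← mulVec_mulVec, hv, mulVec_smul, ih, smul_smul, pow_succ,
          mul_comm]
    refine ⟨∑ p : n × n, l ^ k p.1 p.2, ?_⟩
    rw [sum_mulVec, Finset.sum_smul]
    exact Finset.sum_congr rfl fun p _ => hp _

/-- Collatz–Wielandt: `l` is maximized over the compact set of pairs `(l, x)` with `x` in the
simplex, `0 ≤ l ≤ C` and `l x ≤ M x`. The sum `C` of all entries bounds every competitor with a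
positive vector, as summing its inequalities shows. -/
theorem exists_maximal_subeigenvector [Nonempty n] {M : Matrix n n ℝ} (hM : ∀ i j, 0 ≤ M i j) :
    ∃ (l : ℝ) (x : n → ℝ), (∀ i, 0 ≤ x i) ∧ x ≠ 0 ∧ (∀ i, l * x i ≤ (M *ᵥ x) i) ∧
      ∀ (l' : ℝ) (z : n → ℝ), (∀ i, 0 < z i) → (∀ i, l' * z i ≤ (M *ᵥ z) i) → l' ≤ l := by
  set C : ℝ := ∑ i, ∑ j, M i j with hC
  have hC0 : 0 ≤ C := Finset.sum_nonneg fun i _ => Finset.sum_nonneg fun j _ => hM i j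
  let T : Set (ℝ × (n → ℝ)) :=
    (Set.Icc 0 C ×ˢ stdSimplex ℝ n) ∩ {p | ∀ i, p.1 * p.2 i ≤ (M *ᵥ p.2) i}
  have hT : IsCompact T := by
    refine (isCompact_Icc.prod (isCompact_stdSimplex ℝ n)).inter_right ?_
    simp only [Set.ofPred_forall]
    refine isClosed_iInter fun i => isClosed_le (by fun_prop) ?_
    simp only [mulVec, dotProduct]
    fun_prop
  obtain ⟨i0⟩ := ‹Nonempty n›
  have hne : T.Nonempty :=
    ⟨(0, Pi.single i0 1), ⟨⟨le_rfl, hC0⟩, single_mem_stdSimplex ℝ i0⟩, fun i => by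
      simpa using hM i i0⟩
  obtain ⟨⟨l, x⟩, ⟨⟨hl, hx⟩, hlx⟩, hmax⟩ := hT.exists_isMaxOn hne continuous_fst.continuousOn
  refine ⟨l, x, hx.1, ?_, hlx, fun l' z hz hlz => ?_⟩
  · rintro rfl
    simpa using hx.2
  · rcases lt_or_ge l' 0 with h0 | h0
    · exact h0.le.trans hl.1
    have hs : 0 < ∑ i, z i := Finset.sum_pos (fun i _ => hz i) ⟨i0, Finset.mem_univ _⟩
    have hle : ∀ j, z j ≤ ∑ i, z i := fun j =>
      Finset.single_le_sum (fun i _ => (hz i).le) (Finset.mem_univ j)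
    have hlC : l' ≤ C := by
      have : l' * ∑ i, z i ≤ C * ∑ i, z i := by
        rw [Finset.mul_sum, hC, Finset.sum_mul]
        refine Finset.sum_le_sum fun i _ => (hlz i).trans ?_
        rw [Finset.sum_mul]
        exact Finset.sum_le_sum fun j _ => mul_le_mul_of_nonneg_left (hle j) (hM i j)
      exact le_of_mul_le_mul_right this hs
    refine hmax (a := (l', (∑ i, z i)⁻¹ • z)) ⟨⟨⟨h0, hlC⟩, fun i => ?_, ?_⟩, fun i => ?_⟩
    · exact mul_nonneg (inv_pos.2 hs).le (hz i).le
    · simp only [Pi.smul_apply, smul_eq_mul, ← Finset.mul_sum]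
      exact inv_mul_cancel₀ hs.ne'
    · simp only [mulVec_smul, Pi.smul_apply, smul_eq_mul]
      rw [mul_left_comm]
      exact mul_le_mul_of_nonneg_left (hlz i) (inv_pos.2 hs).le

/-- If the maximal pair had nonzero slack `M x - l x`, applying the positive commuting matrix `B`
would make the slack of `B x` strictly positive everywhere, and `l` could be raised by some `ε`. -/
theorem IsIrreducible.exists_pos_eigenvector [Nonempty n] {M : Matrix n n ℝ}
    (hM : M.IsIrreducible) : ∃ (l : ℝ) (v : n → ℝ), (∀ i, 0 < v i) ∧ M *ᵥ v = l • v := by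
  obtain ⟨B, hB, hBM, -⟩ := hM.exists_commute_pos
  obtain ⟨l, x, hx, hx0, hlx, hmax⟩ := exists_maximal_subeigenvector hM.nonneg
  have hz := mulVec_pos_of_pos hB hx hx0
  have hcomm : M *ᵥ (B *ᵥ x) = B *ᵥ (M *ᵥ x) := by
    rw [mulVec_mulVec, mulVec_mulVec, hBM.eq]
  refine ⟨l, B *ᵥ x, hz, ?_⟩
  by_contra hne
  have hy0 : M *ᵥ x - l • x ≠ 0 := fun h => hne <| by
    rw [hcomm, sub_eq_zero.1 h, mulVec_smul]
  have hy := mulVec_pos_of_pos hB (y := M *ᵥ x - l • x)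
    (fun i => by simpa using hlx i) hy0
  rw [mulVec_sub, ← hcomm, mulVec_smul] at hy
  obtain ⟨i, -, hi⟩ := Finset.exists_min_image Finset.univ
    (fun i => (M *ᵥ (B *ᵥ x) - l • B *ᵥ x) i / (B *ᵥ x) i) Finset.univ_nonempty
  set ε := (M *ᵥ (B *ᵥ x) - l • B *ᵥ x) i / (B *ᵥ x) i with hε
  have hε0 : 0 < ε := div_pos (hy i) (hz i)
  have := hmax (l + ε) (B *ᵥ x) hz fun j => by
    have := (le_div_iff₀ (hz j)).1 (hi j (Finset.mem_univ _))
    simp only [Pi.sub_apply, Pi.smul_apply, smul_eq_mul] at this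
    linarith
  linarith

/-- With `c` the least ratio `v i / w i`, the vector `v - c w` is nonnegative and vanishes at the
minimizing index. It is an eigenvector of the positive matrix `B`, which would make that coordinate
positive unless the vector is zero. -/
theorem IsIrreducible.eigenvector_unique [Nonempty n] {M : Matrix n n ℝ} (hM : M.IsIrreducible)
    {l : ℝ} {v w : n → ℝ} (hv : ∀ i, 0 < v i) (hw : ∀ i, 0 < w i)
    (hMv : M *ᵥ v = l • v) (hMw : M *ᵥ w = l • w) : ∃ c : ℝ, 0 < c ∧ v = c • w := by
  obtain ⟨B, hB, -, hBe⟩ := hM.exists_commute_pos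
  obtain ⟨i, -, hi⟩ := Finset.exists_min_image Finset.univ (fun i => v i / w i)
    Finset.univ_nonempty
  refine ⟨v i / w i, div_pos (hv i) (hw i), ?_⟩
  by_contra hne
  have hpos := mulVec_pos_of_pos hB (y := v - (v i / w i) • w) (fun j => by
    have := (le_div_iff₀ (hw j)).1 (hi j (Finset.mem_univ _))
    simpa using this) (sub_ne_zero.2 hne) i
  obtain ⟨m, hm⟩ := hBe l (v - (v i / w i) • w) (by
    rw [mulVec_sub, mulVec_smul, hMv, hMw, smul_sub, smul_comm])
  rw [hm] at hpos
  simp [div_mul_cancel₀ _ (hw i).ne'] at hpos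

end Matrix

/-- For a complex eigenvector `z`, comparing `‖z‖` with `v` at the index where `‖z i‖ / v i` is
largest bounds the modulus of its eigenvalue by `l`. -/
theorem perronRoot_eq_of_pos_eigenvector {n : Type*} [Fintype n] [DecidableEq n] [Nonempty n]
    {M : Matrix n n ℝ} (hM : ∀ i j, 0 ≤ M i j) {l : ℝ} {v : n → ℝ} (hv : ∀ i, 0 < v i)
    (hMv : M *ᵥ v = l • v) : perronRoot M = l := by
  have hl : 0 ≤ l := by
    obtain ⟨i⟩ := ‹Nonempty n›
    have h1 : 0 ≤ (M *ᵥ v) i := Finset.sum_nonneg fun j _ => mul_nonneg (hM i j) (hv j).le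
    rw [hMv] at h1
    exact nonneg_of_mul_nonneg_left h1 (hv i)
  have hsp : ∀ k : ℂ, k ∈ spectrum ℂ (M.map (fun r : ℝ => (r : ℂ))) ↔
      ∃ z : n → ℂ, z ≠ 0 ∧ M.map (fun r : ℝ => (r : ℂ)) *ᵥ z = k • z := by
    intro k
    rw [← Matrix.spectrum_toLin', ← Module.End.hasEigenvalue_iff_mem_spectrum]
    constructor
    · intro h
      obtain ⟨z, hz⟩ := h.exists_hasEigenvector
      exact ⟨z, hz.2, by simpa using hz.apply_eq_smul⟩
    · rintro ⟨z, hz, hMz⟩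
      exact Module.End.hasEigenvalue_of_hasEigenvector (x := z)
        ⟨Module.End.mem_eigenspace_iff.2 (by simpa using hMz), hz⟩
  have hr : spectralRadius ℂ (M.map (fun r : ℝ => (r : ℂ))) = ENNReal.ofReal l := by
    apply le_antisymm
    · refine iSup₂_le fun k hk => ?_
      obtain ⟨z, hz, hMz⟩ := (hsp k).1 hk
      obtain ⟨i, -, hi⟩ := Finset.exists_max_image Finset.univ (fun i => ‖z i‖ / v i)
        Finset.univ_nonempty
      have hzi : 0 < ‖z i‖ := by
        obtain ⟨j, hj⟩ := Function.ne_iff.1 hz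
        have : 0 < ‖z j‖ / v j := div_pos (norm_pos_iff.2 hj) (hv j)
        exact (div_pos_iff_of_pos_right (hv i)).1 (this.trans_le (hi j (Finset.mem_univ _)))
      have hkey : ‖k‖ * ‖z i‖ ≤ l * ‖z i‖ := by
        calc ‖k‖ * ‖z i‖ = ‖(M.map (fun r : ℝ => (r : ℂ)) *ᵥ z) i‖ := by
              rw [hMz]; simp
          _ ≤ ∑ j, ‖(M i j : ℂ) * z j‖ := norm_sum_le _ _
          _ ≤ ∑ j, (‖z i‖ / v i) * (M i j * v j) := by
              refine Finset.sum_le_sum fun j _ => ?_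
              rw [norm_mul, Complex.norm_real, Real.norm_of_nonneg (hM i j)]
              have := (div_le_iff₀ (hv j)).1 (hi j (Finset.mem_univ _))
              calc M i j * ‖z j‖ ≤ M i j * (‖z i‖ / v i * v j) :=
                    mul_le_mul_of_nonneg_left this (hM i j)
                _ = _ := by ring
          _ = (‖z i‖ / v i) * (M *ᵥ v) i := by rw [← Finset.mul_sum]; rfl
          _ = l * ‖z i‖ := by
              rw [hMv]
              simp only [Pi.smul_apply, smul_eq_mul]
              field_simp [(hv i).ne']
      have := le_of_mul_le_mul_right hkey hzi
      rw [ENNReal.ofReal, ENNReal.coe_le_coe, ← NNReal.coe_le_coe]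
      simpa [hl] using this
    · have hmem : (l : ℂ) ∈ spectrum ℂ (M.map (fun r : ℝ => (r : ℂ))) := by
        refine (hsp l).2 ⟨fun i => (v i : ℂ), ?_, ?_⟩
        · intro h
          obtain ⟨i⟩ := ‹Nonempty n›
          have := congrFun h i
          simp [(hv i).ne'] at this
        · ext i
          have := congrFun hMv i
          simp only [Matrix.mulVec, dotProduct, Pi.smul_apply, smul_eq_mul, Matrix.map_apply]
            at this ⊢
          exact_mod_cast this
      refine le_trans ?_ (le_iSup₂ (f := fun k _ => (‖k‖₊ : ENNReal)) (l : ℂ) hmem)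
      rw [ENNReal.ofReal, ENNReal.coe_le_coe, ← NNReal.coe_le_coe]
      simp [abs_of_nonneg hl, hl]
  rw [perronRoot, hr, ENNReal.toReal_ofReal hl]

/-! ### Natural parameters: stochastic matrices as `ℝ^E` modulo `N` -/

section ExpNormalization

variable {Y : Type*} [Fintype Y] [DecidableEq Y] {E : Finset (Y × Y)}

/-- Any two vertices are joined by a path of positive length. -/
def StronglyConnected (E : Finset (Y × Y)) : Prop :=
  ∀ y y', Relation.TransGen (fun a b => (a, b) ∈ E) y y'

/-- The stochastic matrix with natural parameter `g`. -/
def expNormalization (g : E → ℝ) : Matrix Y Y ℝ :=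
  sNormalization (edgeMatrix fun e : E => Real.exp (g e))

/-- The entrywise logarithm of a matrix on the edge set. -/
def logOn (E : Finset (Y × Y)) (P : Matrix Y Y ℝ) : E → ℝ :=
  fun e => Real.log (P e.1.1 e.1.2)

omit [Fintype Y] in
theorem edgeMatrix_of_mem (F : E → ℝ) {y y' : Y} (h : (y, y') ∈ E) :
    edgeMatrix F y y' = F ⟨(y, y'), h⟩ := by
  simp [edgeMatrix, h]

omit [Fintype Y] in
theorem edgeMatrix_of_notMem (F : E → ℝ) {y y' : Y} (h : (y, y') ∉ E) :
    edgeMatrix F y y' = 0 := by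
  simp [edgeMatrix, h]

omit [Fintype Y] in
theorem edgeMatrix_pos_iff {F : E → ℝ} (hF : ∀ e, 0 < F e) {y y' : Y} :
    0 < edgeMatrix F y y' ↔ (y, y') ∈ E := by
  by_cases h : (y, y') ∈ E
  · simp [edgeMatrix_of_mem F h, h, hF]
  · simp [edgeMatrix_of_notMem F h, h]

omit [Fintype Y] in
theorem edgeMatrix_nonneg {F : E → ℝ} (hF : ∀ e, 0 < F e) (y y' : Y) :
    0 ≤ edgeMatrix F y y' := by
  by_cases h : (y, y') ∈ E
  · exact ((edgeMatrix_pos_iff hF).2 h).le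
  · exact (edgeMatrix_of_notMem F h).ge

omit [Fintype Y] in
theorem edgeMatrix_isIrreducible (hE : StronglyConnected E) {F : E → ℝ} (hF : ∀ e, 0 < F e) :
    (edgeMatrix F).IsIrreducible := by
  rw [Matrix.isIrreducible_iff_transGen (edgeMatrix_nonneg hF)]
  simpa only [edgeMatrix_pos_iff hF, StronglyConnected] using hE

theorem stronglyConnected_of_mem {P : Matrix Y Y ℝ} (hP : P ∈ stochasticFamily E) :
    StronglyConnected E := by
  have := (Matrix.isIrreducible_iff_transGen hP.2.1.nonneg).1 hP.2.1
  simpa only [hP.2.2, StronglyConnected] using this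

/-- The default value `0` of `perronVector` is never taken on a strongly connected graph with
positive weights. -/
theorem perronVector_spec [Nonempty Y] (hE : StronglyConnected E) {F : E → ℝ}
    (hF : ∀ e, 0 < F e) :
    (∀ y, 0 < perronVector (edgeMatrix F) y) ∧
      edgeMatrix F *ᵥ perronVector (edgeMatrix F) =
        perronRoot (edgeMatrix F) • perronVector (edgeMatrix F) := by
  have h : ∃ v : Y → ℝ, (∀ y, 0 < v y) ∧ edgeMatrix F *ᵥ v = perronRoot (edgeMatrix F) • v := by
    obtain ⟨l, v, hv, hMv⟩ := (edgeMatrix_isIrreducible hE hF).exists_pos_eigenvector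
    refine ⟨v, hv, ?_⟩
    rw [perronRoot_eq_of_pos_eigenvector (edgeMatrix_nonneg hF) hv hMv, hMv]
  rw [perronVector, dif_pos h]
  exact h.choose_spec

theorem eigenvalue_pos [Nonempty Y] (hE : StronglyConnected E) {F : E → ℝ}
    (hF : ∀ e, 0 < F e) {v : Y → ℝ} (hv : ∀ y, 0 < v y) {l : ℝ}
    (hl : edgeMatrix F *ᵥ v = l • v) : 0 < l := by
  obtain ⟨y⟩ := ‹Nonempty Y›
  obtain ⟨y', hy', -⟩ := Relation.TransGen.head'_iff.1 (hE y y)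
  have h : 0 < (edgeMatrix F *ᵥ v) y :=
    Finset.sum_pos' (fun a _ => mul_nonneg (edgeMatrix_nonneg hF _ _) (hv a).le)
      ⟨y', Finset.mem_univ _, mul_pos ((edgeMatrix_pos_iff hF).2 hy') (hv y')⟩
  rw [hl] at h
  exact pos_of_mul_pos_left h (hv y).le

/-- The normalization can be computed with any positive eigenvector. -/
theorem sNormalization_eq [Nonempty Y] (hE : StronglyConnected E) {F : E → ℝ}
    (hF : ∀ e, 0 < F e) {v : Y → ℝ} (hv : ∀ y, 0 < v y) {l : ℝ}
    (hl : edgeMatrix F *ᵥ v = l • v) (y y' : Y) :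
    sNormalization (edgeMatrix F) y y' = edgeMatrix F y y' * v y' / (l * v y) := by
  have hr := perronRoot_eq_of_pos_eigenvector (edgeMatrix_nonneg hF) hv hl
  obtain ⟨hw, hMw⟩ := perronVector_spec hE hF
  rw [hr] at hMw
  obtain ⟨c, hc, h⟩ := (edgeMatrix_isIrreducible hE hF).eigenvector_unique hw hv hMw hl
  simp only [sNormalization, Matrix.of_apply, hr, h, Pi.smul_apply, smul_eq_mul]
  have := eigenvalue_pos hE hF hv hl
  have := hv y
  field_simp

theorem sNormalization_mem [Nonempty Y] (hE : StronglyConnected E) {F : E → ℝ}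
    (hF : ∀ e, 0 < F e) : sNormalization (edgeMatrix F) ∈ stochasticFamily E := by
  obtain ⟨hv, hl⟩ := perronVector_spec hE hF
  set v := perronVector (edgeMatrix F)
  set l := perronRoot (edgeMatrix F)
  have hl0 := eigenvalue_pos hE hF hv hl
  have happ : ∀ y y', sNormalization (edgeMatrix F) y y' = edgeMatrix F y y' * v y' / (l * v y) :=
    fun y y' => rfl
  have hpos : ∀ y y', 0 < sNormalization (edgeMatrix F) y y' ↔ (y, y') ∈ E := fun y y' => by
    rw [happ, div_pos_iff_of_pos_right (mul_pos hl0 (hv y)), mul_pos_iff_of_pos_right (hv y'),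
      edgeMatrix_pos_iff hF]
  have hnn : ∀ y y', 0 ≤ sNormalization (edgeMatrix F) y y' := fun y y' =>
    div_nonneg (mul_nonneg (edgeMatrix_nonneg hF _ _) (hv y').le) (mul_pos hl0 (hv y)).le
  refine ⟨Matrix.mem_rowStochastic_iff_sum.2 ⟨hnn, fun y => ?_⟩, ?_, hpos⟩
  · have h : (edgeMatrix F *ᵥ v) y = l * v y := congrFun hl y
    simp only [happ, ← Finset.sum_div]
    exact (div_eq_one_iff_eq (mul_pos hl0 (hv y)).ne').2 h
  · rw [Matrix.isIrreducible_iff_transGen hnn]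
    simpa only [hpos, StronglyConnected] using hE

theorem expNormalization_mem [Nonempty Y] (hE : StronglyConnected E) (g : E → ℝ) :
    expNormalization g ∈ stochasticFamily E :=
  sNormalization_mem hE fun _ => Real.exp_pos _

theorem edgeMatrix_exp_logOn {P : Matrix Y Y ℝ} (hP : P ∈ stochasticFamily E) :
    edgeMatrix (fun e : E => Real.exp (logOn E P e)) = P := by
  ext y y'
  by_cases h : (y, y') ∈ E
  · rw [edgeMatrix_of_mem _ h, logOn, Real.exp_log ((hP.2.2 _ _).2 h)]
  · rw [edgeMatrix_of_notMem _ h]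
    exact le_antisymm (hP.2.1.nonneg _ _) (not_lt.1 fun h' => h ((hP.2.2 _ _).1 h'))

/-- The constant vector is an eigenvector with eigenvalue one, so normalizing changes nothing; every
member of `W(Y, E)` has a natural parameter. -/
theorem expNormalization_logOn [Nonempty Y] {P : Matrix Y Y ℝ} (hP : P ∈ stochasticFamily E) :
    expNormalization (logOn E P) = P := by
  ext y y'
  rw [expNormalization, sNormalization_eq (stronglyConnected_of_mem hP) (fun _ => Real.exp_pos _)
    (v := 1) (l := 1) (fun _ => one_pos), edgeMatrix_exp_logOn hP]
  · simp
  · rw [edgeMatrix_exp_logOn hP, Matrix.one_vecMul_of_mem_rowStochastic hP.1, one_smul]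

/-- After taking logarithms, the eigenvector ratio becomes a difference of potentials and the Perron
root a constant. -/
theorem logOn_sNormalization_sub_mem [Nonempty Y] (hE : StronglyConnected E) {F : E → ℝ}
    (hF : ∀ e, 0 < F e) :
    (logOn E (sNormalization (edgeMatrix F)) - fun e => Real.log (F e)) ∈ antiShift E := by
  obtain ⟨hv, hl⟩ := perronVector_spec hE hF
  have hl0 := eigenvalue_pos hE hF hv hl
  refine ⟨-Real.log (perronRoot (edgeMatrix F)),
    fun y => Real.log (perronVector (edgeMatrix F) y), fun e => ?_⟩
  simp only [logOn, sNormalization, Matrix.of_apply, Pi.sub_apply]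
  rw [edgeMatrix_of_mem F e.2, Real.log_div (mul_pos (hF _) (hv _)).ne' (mul_pos hl0 (hv _)).ne',
    Real.log_mul (hF _).ne' (hv _).ne', Real.log_mul hl0.ne' (hv _).ne']
  ring

theorem logOn_expNormalization_sub_mem [Nonempty Y] (hE : StronglyConnected E) (g : E → ℝ) :
    logOn E (expNormalization g) - g ∈ antiShift E := by
  have := logOn_sNormalization_sub_mem hE fun e : E => Real.exp_pos (g e)
  simp only [Real.log_exp] at this
  exact this

/-- Adding an element of `N` conjugates the weights by the diagonal matrix `exp f` and scales them
by `exp c`. The eigenvector becomes `v / exp f` and the eigenvalue `l * exp c`, and all the changes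
cancel. -/
theorem expNormalization_eq_iff [Nonempty Y] (hE : StronglyConnected E) (g g' : E → ℝ) :
    expNormalization g = expNormalization g' ↔ g - g' ∈ antiShift E := by
  constructor
  · intro h
    have h1 := logOn_expNormalization_sub_mem hE g
    have h2 := logOn_expNormalization_sub_mem hE g'
    rw [h] at h1
    simpa using sub_mem h2 h1
  · rintro ⟨c, f, hf⟩
    obtain ⟨hv, hl⟩ := perronVector_spec hE fun e : E => Real.exp_pos (g' e)
    set v := perronVector (edgeMatrix fun e : E => Real.exp (g' e)) with hvdef
    set l := perronRoot (edgeMatrix fun e : E => Real.exp (g' e)) with hldef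
    have hmat : ∀ y y', edgeMatrix (fun e : E => Real.exp (g e)) y y' =
        edgeMatrix (fun e : E => Real.exp (g' e)) y y' *
          (Real.exp (f y') / Real.exp (f y) * Real.exp c) := by
      intro y y'
      by_cases h : (y, y') ∈ E
      · have := hf ⟨(y, y'), h⟩
        simp only [Pi.sub_apply] at this
        rw [edgeMatrix_of_mem _ h, edgeMatrix_of_mem _ h, ← Real.exp_sub, ← Real.exp_add,
          ← Real.exp_add]
        congr 1
        linarith
      · rw [edgeMatrix_of_notMem _ h, edgeMatrix_of_notMem _ h, zero_mul]
    have hl0 := eigenvalue_pos hE (fun e : E => Real.exp_pos (g' e)) hv hl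
    ext y y'
    rw [expNormalization, sNormalization_eq hE (fun _ => Real.exp_pos _)
      (v := fun y => v y / Real.exp (f y)) (l := l * Real.exp c)
      (fun y => div_pos (hv y) (Real.exp_pos _)), expNormalization,
      sNormalization_eq hE (fun _ => Real.exp_pos _) hv hl, hmat]
    · have := hv y
      field_simp
    · ext y
      have h : ∑ y', edgeMatrix (fun e : E => Real.exp (g' e)) y y' * v y' = l * v y :=
        congrFun hl y
      simp only [Matrix.mulVec, dotProduct, hmat, Pi.smul_apply, smul_eq_mul]
      calc _ = ∑ y', (Real.exp c / Real.exp (f y)) *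
            (edgeMatrix (fun e : E => Real.exp (g' e)) y y' * v y') :=
            Finset.sum_congr rfl fun y' _ => by field_simp
        _ = _ := by rw [← Finset.mul_sum, h]; field_simp

/-- A subset of the stochastic matrices cut out by a linear subspace in natural parameters is an
exponential family. -/
theorem isEFamily_of_submodule [Nonempty Y] (hE : StronglyConnected E)
    {V : Set (Matrix Y Y ℝ)} (hV : V ⊆ stochasticFamily E) (S : Submodule ℝ (E → ℝ))
    (hS : ∀ g : E → ℝ, expNormalization g ∈ V ↔ g ∈ S) : IsEFamily E V := by
  -- The generators are lifts to `S` of a basis of its image modulo `N`; the base point is zero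
  -- since `S` is linear.
  refine ⟨hV, Module.finrank ℝ (S.map (antiShift E).mkQ), 0, ?_⟩
  let b := Module.finBasis ℝ (S.map (antiShift E).mkQ)
  have hb : ∀ i, ∃ g ∈ S, (antiShift E).mkQ g = b i := fun i => (b i).2
  choose G hGS hG using hb
  refine ⟨G, ?_, ?_⟩
  · simp only [hG]
    exact b.linearIndependent.map' (S.map (antiShift E).mkQ).subtype (Submodule.ker_subtype _)
  have key : ∀ θ : Fin (Module.finrank ℝ (S.map (antiShift E).mkQ)) → ℝ,
      sNormalization (edgeMatrix fun e : E => Real.exp ((0 : E → ℝ) e + ∑ i, θ i * G i e)) =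
        expNormalization (∑ i, θ i • G i) := fun θ => by
    simp [expNormalization]
  simp only [key]
  apply Set.Subset.antisymm
  · intro P hP
    have hPE := hV hP
    have hlog : logOn E P ∈ S := (hS _).1 (by rwa [expNormalization_logOn hPE])
    have hm : (antiShift E).mkQ (logOn E P) ∈ S.map (antiShift E).mkQ :=
      Submodule.mem_map_of_mem hlog
    refine ⟨fun i => b.repr ⟨_, hm⟩ i, ?_⟩
    have hsum := congrArg Subtype.val (b.sum_repr ⟨_, hm⟩)
    refine Eq.trans ?_ (expNormalization_logOn hPE)
    rw [expNormalization_eq_iff hE, ← Submodule.Quotient.eq]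
    simp only [Submodule.coe_sum, Submodule.coe_smul, ← hG, ← map_smul, ← map_sum] at hsum
    exact hsum
  · rintro _ ⟨θ, rfl⟩
    exact (hS _).2 (Submodule.sum_mem _ fun i _ => S.smul_mem _ (hGS i))

/-- In natural parameters, an exponential family is closed under affine combinations. -/
theorem IsEFamily.affine [Nonempty Y] (hE : StronglyConnected E) {V : Set (Matrix Y Y ℝ)}
    (hV : IsEFamily E V) {p q : E → ℝ} (hp : expNormalization p ∈ V)
    (hq : expNormalization q ∈ V) (t : ℝ) :
    expNormalization (p + t • (q - p)) ∈ V := by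
  obtain ⟨-, d, K, G, -, rfl⟩ := hV
  have key : ∀ θ : Fin d → ℝ,
      sNormalization (edgeMatrix fun e : E => Real.exp (K e + ∑ i, θ i * G i e)) =
        expNormalization (K + ∑ i, θ i • G i) := fun θ => by
    simp [expNormalization]
  simp only [key] at hp hq ⊢
  obtain ⟨θ, hθ⟩ := hp
  obtain ⟨η, hη⟩ := hq
  simp only [expNormalization_eq_iff hE] at hθ hη
  refine ⟨θ + t • (η - θ), ?_⟩
  simp only [expNormalization_eq_iff hE]
  convert add_mem hθ ((antiShift E).smul_mem t (sub_mem hη hθ)) using 1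
  simp only [Pi.add_apply, Pi.smul_apply, Pi.sub_apply, add_smul, sub_smul, smul_eq_mul,
    Finset.sum_add_distrib, Finset.sum_sub_distrib, mul_smul, ← Finset.smul_sum, smul_sub, smul_add]
  abel

end ExpNormalization

/-! ### Lumpability as equality of block row sums -/

section Lumping

variable {Y X : Type*} [Fintype Y] [DecidableEq X]

/-- The block row sums of `P` depend only on the blocks. -/
def IsBlockConstant (κ : Y → X) (P : Matrix Y Y ℝ) : Prop :=
  ∀ x' y₁ y₂, κ y₁ = κ y₂ → ∑ y' with κ y' = x', P y₁ y' = ∑ y' with κ y' = x', P y₂ y'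

variable [DecidableEq Y]

omit [DecidableEq Y] in
-- Isolates the last transition, the only place where the Markov property of the lumped process has
-- to be tested.
theorem lumpedPathProb_succ (μ : Y → ℝ) (P : Matrix Y Y ℝ) (κ : Y → X) (n : ℕ)
    (x : Fin (n + 2) → X) :
    lumpedPathProb μ P κ (n + 1) x =
      ∑ y : Fin (n + 1) → Y with ∀ i, κ (y i) = x i.castSucc,
        (μ (y 0) * ∏ i : Fin n, P (y i.castSucc) (y i.succ)) *
          ∑ y' with κ y' = x (Fin.last (n + 1)), P (y (Fin.last n)) y' := by
  unfold lumpedPathProb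
  simp only [Finset.sum_filter]
  rw [← (Fin.snocEquiv fun _ : Fin (n + 2) => Y).sum_comp, Fintype.sum_prod_type_right]
  refine Finset.sum_congr rfl fun y _ => ?_
  have h0 : ∀ y' : Y, (Fin.snoc y y' : Fin (n + 2) → Y) 0 = y 0 := fun y' => by
    have : (0 : Fin (n + 2)) = Fin.castSucc 0 := rfl
    rw [this, Fin.snoc_castSucc (α := fun _ => Y)]
  have hprod : ∀ y' : Y, ∏ i : Fin (n + 1), P ((Fin.snoc y y' : Fin (n + 2) → Y) i.castSucc)
      ((Fin.snoc y y' : Fin (n + 2) → Y) i.succ) =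
        (∏ i : Fin n, P (y i.castSucc) (y i.succ)) * P (y (Fin.last n)) y' := fun y' => by
    rw [Fin.prod_univ_castSucc]
    simp only [Fin.succ_castSucc, Fin.snoc_castSucc (α := fun _ => Y), Fin.succ_last,
      Fin.snoc_last (α := fun _ => Y)]
  have hcond : ∀ y' : Y, (∀ i, κ ((Fin.snoc y y' : Fin (n + 2) → Y) i) = x i) ↔
      (∀ i, κ (y i) = x i.castSucc) ∧ κ y' = x (Fin.last (n + 1)) := fun y' => by
    rw [Fin.forall_fin_succ']
    simp only [Fin.snoc_castSucc (α := fun _ => Y), Fin.snoc_last (α := fun _ => Y)]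
  have hterm : ∀ y' : Y, (Fin.snocEquiv fun _ : Fin (n + 2) => Y) (y', y) = Fin.snoc y y' :=
    fun _ => rfl
  simp only [hterm, hcond, h0, hprod]
  by_cases h : ∀ i : Fin (n + 1), κ (y i) = x i.castSucc
  · rw [if_pos h, Finset.mul_sum]
    refine Finset.sum_congr rfl fun y' _ => ?_
    by_cases h' : κ y' = x (Fin.last (n + 1))
    · rw [if_pos ⟨fun i => h i, h'⟩, if_pos h', mul_assoc]
    · rw [if_neg fun hh => h' hh.2, if_neg h', mul_zero]
  · rw [if_neg h]
    exact Finset.sum_eq_zero fun y' _ => if_neg fun hh => h hh.1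

/-- One transition from a point mass at `y` reads off the block sums of row `y` as entries of `Q`.
Conversely, constant block sums factor out of the last transition of every path. -/
theorem isLumpable_iff_isBlockConstant [Fintype X] {κ : Y → X} (hκ : Function.Surjective κ)
    {P : Matrix Y Y ℝ} (hP : P ∈ Matrix.rowStochastic ℝ Y) :
    IsLumpable κ P ↔ IsBlockConstant κ P := by
  constructor
  · rintro ⟨Q, -, hQ⟩
    have key : ∀ y x', ∑ y' with κ y' = x', P y y' = Q (κ y) x' := by
      intro y x'
      have := hQ (Pi.single y 1) (single_mem_stdSimplex ℝ y) 0 ![κ y, x']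
      rw [lumpedPathProb_succ] at this
      simp only [lumpedPathProb] at this
      have hs : ∀ f : (Fin 1 → Y) → ℝ, ∑ z : Fin 1 → Y, f z = ∑ a, f fun _ => a := fun f =>
        ((Equiv.funUnique (Fin 1) Y).symm.sum_comp f).symm
      simp only [Finset.sum_filter, hs] at this
      simpa [Pi.single_apply, Finset.sum_ite, Finset.filter_eq', Finset.filter_filter] using this
    intro x' y₁ y₂ h
    rw [key, key, h]
  · intro h
    choose s hs using hκ
    have key : ∀ y x', ∑ y' with κ y' = x', P y y' = ∑ y' with κ y' = x', P (s (κ y)) y' :=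
      fun y x' => h _ _ _ (hs _).symm
    refine ⟨Matrix.of fun x x' => ∑ y' with κ y' = x', P (s x) y', ?_, ?_⟩
    · refine Matrix.mem_rowStochastic_iff_sum.2 ⟨fun x x' => Finset.sum_nonneg fun y' _ =>
        Matrix.nonneg_of_mem_rowStochastic hP, fun x => ?_⟩
      simp only [Matrix.of_apply]
      rw [Finset.sum_fiberwise, Matrix.sum_row_of_mem_rowStochastic hP]
    · intro μ _ n x
      rw [lumpedPathProb_succ, lumpedPathProb, Finset.sum_mul]
      refine Finset.sum_congr rfl fun y hy => ?_
      rw [key, (Finset.mem_filter.1 hy).2]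
      rfl

variable {E : Finset (Y × Y)} {κ : Y → X}

/-- For pairs of blocks outside `D` both sums vanish. -/
theorem isBlockConstant_edgeMatrix {F : E → ℝ}
    (hF : ∀ p ∈ lumpedEdges κ E, ∀ y₁ y₂, κ y₁ = p.1 → κ y₂ = p.1 →
      ∑ y' with κ y' = p.2, edgeMatrix F y₁ y' = ∑ y' with κ y' = p.2, edgeMatrix F y₂ y') :
    IsBlockConstant κ (edgeMatrix F) := by
  intro x' y₁ y₂ h
  by_cases hp : (κ y₁, x') ∈ lumpedEdges κ E
  · exact hF _ hp _ _ rfl h.symm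
  · have h0 : ∀ y, κ y = κ y₁ → ∑ y' with κ y' = x', edgeMatrix F y y' = 0 := by
      intro y hy
      refine Finset.sum_eq_zero fun y' hy' => edgeMatrix_of_notMem F fun he => hp ?_
      exact Finset.mem_image.2 ⟨_, he, by simp [hy, (Finset.mem_filter.1 hy').2]⟩
    rw [h0 _ rfl, h0 _ h.symm]

theorem logOn_mem_logLumpableCone [Fintype X] (hκ : Function.Surjective κ) {P : Matrix Y Y ℝ}
    (hP : P ∈ lumpableFamily κ E) : logOn E P ∈ logLumpableCone κ E := by
  have h := edgeMatrix_exp_logOn hP.1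
  have hb := (isLumpable_iff_isBlockConstant hκ hP.1.1).1 hP.2
  refine ⟨fun e => Real.exp (logOn E P e), fun e => Real.exp_pos _, ?_, fun e => by simp⟩
  rw [h]
  exact fun p _ y₁ y₂ h₁ h₂ => hb _ _ _ (h₁.trans h₂.symm)

/-- The lumped matrix `L` is irreducible, and its positive eigenvector pulled back along `κ` is one
for `F`. Being constant on blocks, it makes normalization multiply each block sum by a factor
depending only on the two blocks. -/
theorem sNormalization_mem_lumpableFamily [Nonempty Y] [Fintype X] (hκ : Function.Surjective κ)
    (hE : StronglyConnected E) {F : E → ℝ} (hF : ∀ e, 0 < F e)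
    (hb : IsBlockConstant κ (edgeMatrix F)) :
    sNormalization (edgeMatrix F) ∈ lumpableFamily κ E := by
  have hmem := sNormalization_mem hE hF
  refine ⟨hmem, (isLumpable_iff_isBlockConstant hκ hmem.1).2 ?_⟩
  obtain ⟨s, hs⟩ := hκ.hasRightInverse
  have : Nonempty X := ‹Nonempty Y›.map κ
  set L : Matrix X X ℝ := Matrix.of fun x x' => ∑ y' with κ y' = x', edgeMatrix F (s x) y' with hL
  have key : ∀ y x', ∑ y' with κ y' = x', edgeMatrix F y y' = L (κ y) x' :=
    fun y x' => hb _ _ _ (hs _).symm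
  have hnn : ∀ x x', 0 ≤ L x x' := fun x x' =>
    Finset.sum_nonneg fun y' _ => edgeMatrix_nonneg hF _ _
  have hirr : L.IsIrreducible := by
    rw [Matrix.isIrreducible_iff_transGen hnn]
    intro x x'
    have := Relation.TransGen.lift (p := fun a b => 0 < L a b) κ (fun a b hab => ?_)
      _ _ (hE (s x) (s x'))
    · simpa only [Function.onFun, hs x, hs x'] using this
    · change 0 < L (κ a) (κ b)
      rw [← key]
      exact Finset.sum_pos' (fun y' _ => edgeMatrix_nonneg hF _ _)
        ⟨b, by simp, (edgeMatrix_pos_iff hF).2 hab⟩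
  obtain ⟨l, w, hw, hl⟩ := hirr.exists_pos_eigenvector
  have heig : edgeMatrix F *ᵥ (w ∘ κ) = l • (w ∘ κ) := by
    ext y
    have h : ∑ x', L (κ y) x' * w x' = l * w (κ y) := congrFun hl (κ y)
    simp only [Matrix.mulVec, dotProduct, Pi.smul_apply, smul_eq_mul, Function.comp_apply]
    rw [← h, ← Finset.sum_fiberwise (g := κ)]
    refine Finset.sum_congr rfl fun x' _ => ?_
    rw [← key, Finset.sum_mul]
    exact Finset.sum_congr rfl fun y' hy' => by rw [(Finset.mem_filter.1 hy').2]
  intro x' y₁ y₂ h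
  simp only [sNormalization_eq hE hF (fun y => hw (κ y)) heig]
  have hsum : ∀ y, ∑ y' with κ y' = x', edgeMatrix F y y' * w (κ y') / (l * w (κ y)) =
      L (κ y) x' * w x' / (l * w (κ y)) := fun y => by
    rw [← Finset.sum_div, ← key, Finset.sum_mul]
    congr 1
    exact Finset.sum_congr rfl fun y' hy' => by rw [(Finset.mem_filter.1 hy').2]
  rw [hsum, hsum, h]

theorem expNormalization_mem_of_mem_logLumpableCone [Nonempty Y] [Fintype X]
    (hκ : Function.Surjective κ) (hE : StronglyConnected E) {g : E → ℝ}
    (hg : g ∈ logLumpableCone κ E) : expNormalization g ∈ lumpableFamily κ E := by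
  obtain ⟨F, hF, hb, hgF⟩ := hg
  have h : (fun e => Real.exp (g e)) = F := funext fun e => by rw [hgF, Real.exp_log (hF e)]
  rw [expNormalization, h]
  exact sNormalization_mem_lumpableFamily hκ hE hF (isBlockConstant_edgeMatrix hb)

/-- In natural parameters the lumpable family is `G_κ + N`; the e-family question becomes whether
this set is affine. -/
theorem expNormalization_mem_lumpableFamily_iff [Nonempty Y] [Fintype X]
    (hκ : Function.Surjective κ) (hE : StronglyConnected E) (g : E → ℝ) :
    expNormalization g ∈ lumpableFamily κ E ↔
      ∃ h ∈ logLumpableCone κ E, g - h ∈ antiShift E := by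
  constructor
  · intro hg
    refine ⟨_, logOn_mem_logLumpableCone hκ hg, ?_⟩
    simpa using neg_mem (logOn_expNormalization_sub_mem hE g)
  · rintro ⟨h, hh, hgh⟩
    rw [(expNormalization_eq_iff hE g h).2 hgh]
    exact expNormalization_mem_of_mem_logLumpableCone hκ hE hh

/-- Within a block that carries several states, each state has at most one edge to any block. -/
def HasSingleEdges (κ : Y → X) (E : Finset (Y × Y)) : Prop :=
  ∀ y₁ y₂, y₁ ≠ y₂ → κ y₁ = κ y₂ → ∀ y y', κ y = κ y' → (y₁, y) ∈ E → (y₁, y') ∈ E → y = y'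

omit [Fintype Y] [DecidableEq X] [DecidableEq Y] in
theorem hasSingleEdges_of_injective (hκ : Function.Injective κ) : HasSingleEdges κ E :=
  fun _ _ hne h => absurd (hκ h) hne

/-- Lumpability of a function on the edges of a graph with single edges is a condition on pairs
of edges. -/
theorem mem_logLumpableCone_iff_of_hasSingleEdges (hs : HasSingleEdges κ E)
    (hc : ∀ e ∈ E, ∀ y, κ y = κ e.1 → ∃ y', κ y' = κ e.2 ∧ (y, y') ∈ E) (g : E → ℝ) :
    g ∈ logLumpableCone κ E ↔ ∀ e e' : E, e.1.1 ≠ e'.1.1 → κ e.1.1 = κ e'.1.1 →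
      κ e.1.2 = κ e'.1.2 → g e = g e' := by
  have hsum : ∀ (F : E → ℝ) (e : E) y₂, e.1.1 ≠ y₂ → κ e.1.1 = κ y₂ →
      ∑ y' with κ y' = κ e.1.2, edgeMatrix F e.1.1 y' = F e := by
    intro F e y₂ hne h
    rw [Finset.sum_eq_single e.1.2]
    · exact edgeMatrix_of_mem F e.2
    · intro y' hy' hy
      exact edgeMatrix_of_notMem F fun he =>
        hy (hs _ _ hne h _ _ (Finset.mem_filter.1 hy').2 he e.2)
    · simp
  constructor
  · rintro ⟨F, hF, hb, hg⟩ e e' hne h₁ h₂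
    have := isBlockConstant_edgeMatrix hb (κ e.1.2) _ _ h₁
    rw [hsum F e _ hne h₁, h₂, hsum F e' _ hne.symm h₁.symm] at this
    rw [hg, hg, this]
  · intro h
    refine ⟨fun e => Real.exp (g e), fun e => Real.exp_pos _, ?_, fun e => by simp⟩
    intro p hp y₁ y₂ h₁ h₂
    obtain ⟨e, he, rfl⟩ := Finset.mem_image.1 hp
    by_cases hne : y₁ = y₂
    · rw [hne]
    obtain ⟨z₁, hz₁, hE₁⟩ := hc e he y₁ h₁
    obtain ⟨z₂, hz₂, hE₂⟩ := hc e he y₂ h₂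
    have e₁ := hsum (fun e => Real.exp (g e)) ⟨_, hE₁⟩ y₂ hne (h₁.trans h₂.symm)
    have e₂ := hsum (fun e => Real.exp (g e)) ⟨_, hE₂⟩ y₁ (Ne.symm hne) (h₂.trans h₁.symm)
    simp only [hz₁] at e₁
    simp only [hz₂] at e₂
    dsimp only
    rw [e₁, e₂, h ⟨_, hE₁⟩ ⟨_, hE₂⟩ hne (h₁.trans h₂.symm) (hz₁.trans hz₂.symm)]

/-- Every state of a block has an edge to each block reachable from its own one. -/
theorem exists_edge_of_mem_lumpableFamily [Fintype X] (hκ : Function.Surjective κ)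
    {P : Matrix Y Y ℝ} (hP : P ∈ lumpableFamily κ E) :
    ∀ e ∈ E, ∀ y, κ y = κ e.1 → ∃ y', κ y' = κ e.2 ∧ (y, y') ∈ E := by
  intro e he y hy
  have hb := (isLumpable_iff_isBlockConstant hκ hP.1.1).1 hP.2 (κ e.2) _ _ hy
  have hpos : 0 < ∑ y' with κ y' = κ e.2, P e.1 y' :=
    Finset.sum_pos' (fun _ _ => hP.1.2.1.nonneg _ _) ⟨e.2, by simp, (hP.1.2.2 _ _).2 he⟩
  rw [← hb] at hpos
  obtain ⟨y', hy', h⟩ := Finset.exists_ne_zero_of_sum_ne_zero hpos.ne'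
  exact ⟨y', (Finset.mem_filter.1 hy').2,
    (hP.1.2.2 _ _).1 ((hP.1.2.1.nonneg _ _).lt_of_ne' h)⟩

/-- Here `G_κ` is the subspace `C` cut out by equalities between edge values, so `G_κ + N` is
linear. -/
theorem isEFamily_of_hasSingleEdges [Nonempty Y] [Fintype X] (hκ : Function.Surjective κ)
    (hW : (lumpableFamily κ E).Nonempty) (hs : HasSingleEdges κ E) :
    IsEFamily E (lumpableFamily κ E) := by
  obtain ⟨P, hP⟩ := hW
  have hE := stronglyConnected_of_mem hP.1
  have hc := exists_edge_of_mem_lumpableFamily hκ hP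
  let C : Submodule ℝ (E → ℝ) :=
    { carrier := {g | ∀ e e' : E, e.1.1 ≠ e'.1.1 → κ e.1.1 = κ e'.1.1 →
        κ e.1.2 = κ e'.1.2 → g e = g e'}
      zero_mem' := fun _ _ _ _ _ => rfl
      add_mem' := fun ha hb e e' h₁ h₂ h₃ =>
        congrArg₂ (· + ·) (ha e e' h₁ h₂ h₃) (hb e e' h₁ h₂ h₃)
      smul_mem' := fun c _ ha e e' h₁ h₂ h₃ => congrArg (c * ·) (ha e e' h₁ h₂ h₃) }
  refine isEFamily_of_submodule hE (fun _ h => h.1) (C ⊔ antiShift E) fun g => ?_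
  rw [expNormalization_mem_lumpableFamily_iff hκ hE, Submodule.mem_sup]
  constructor
  · rintro ⟨h, hh, hgh⟩
    exact ⟨h, (mem_logLumpableCone_iff_of_hasSingleEdges hs hc h).1 hh, _, hgh, by abel⟩
  · rintro ⟨h, hh, n, hn, rfl⟩
    exact ⟨h, (mem_logLumpableCone_iff_of_hasSingleEdges hs hc h).2 hh, by simpa using hn⟩

/-- With a single block, block sums are full row sums and every stochastic matrix is lumpable. With
`κ` bijective, blocks are singletons and the single-edge condition is vacuous. -/
theorem isEFamily_of_isDegenerate [Nonempty Y] [Fintype X] (hκ : Function.Surjective κ)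
    (hW : (lumpableFamily κ E).Nonempty) (hd : IsDegenerate κ) :
    IsEFamily E (lumpableFamily κ E) := by
  rcases hd with h | h
  · obtain ⟨P, hP⟩ := hW
    have hE := stronglyConnected_of_mem hP.1
    have : Subsingleton X := Fintype.card_le_one_iff_subsingleton.1 h.le
    refine isEFamily_of_submodule hE (fun _ h => h.1) ⊤ fun g => iff_of_true ?_ trivial
    have hmem := expNormalization_mem hE g
    refine ⟨hmem, (isLumpable_iff_isBlockConstant hκ hmem.1).2 fun x' y₁ y₂ _ => ?_⟩
    simp only [Subsingleton.elim _ x', Finset.filter_true,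
      Matrix.sum_row_of_mem_rowStochastic hmem.1]
  · exact isEFamily_of_hasSingleEdges hκ hW (hasSingleEdges_of_injective
      ((Fintype.bijective_iff_surjective_and_card κ).2 ⟨hκ, h.symm⟩).1)

/-- A graph with uniform out-edges to reachable blocks carries lumpable chains. -/
theorem lumpableFamily_nonempty [Nonempty Y] [Fintype X] (hκ : Function.Surjective κ)
    (hE : StronglyConnected E)
    (hc : ∀ e ∈ E, ∀ y, κ y = κ e.1 → ∃ y', κ y' = κ e.2 ∧ (y, y') ∈ E) :
    (lumpableFamily κ E).Nonempty := by
  let N : Y → X → Finset Y := fun y x => {y' | κ y' = x ∧ (y, y') ∈ E}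
  -- Equal weights on the edges from a state to a block make each nonempty block sum equal to one.
  let F : E → ℝ := fun e => ((N e.1.1 (κ e.1.2)).card : ℝ)⁻¹
  have hF : ∀ e, 0 < F e := fun e => inv_pos.2 <| Nat.cast_pos.2 <| Finset.card_pos.2
    ⟨e.1.2, by simp [N]⟩
  refine ⟨_, sNormalization_mem_lumpableFamily hκ hE hF (isBlockConstant_edgeMatrix ?_)⟩
  have hone : ∀ e ∈ E, ∀ y, κ y = κ e.1 → ∑ y' with κ y' = κ e.2, edgeMatrix F y y' = 1 := by
    intro e he y hy
    have hne : (N y (κ e.2)).Nonempty := by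
      obtain ⟨y', h₁, h₂⟩ := hc e he y hy
      exact ⟨y', by simp [N, h₁, h₂]⟩
    have hterm : ∀ y', κ y' = κ e.2 → edgeMatrix F y y' =
        if (y, y') ∈ E then ((N y (κ e.2)).card : ℝ)⁻¹ else 0 := by
      intro y' h
      split_ifs with hy'
      · rw [edgeMatrix_of_mem F hy', ← h]
      · exact edgeMatrix_of_notMem F hy'
    rw [Finset.sum_congr rfl fun y' hy' => hterm y' (Finset.mem_filter.1 hy').2,
      ← Finset.sum_filter, Finset.filter_filter, Finset.sum_const, nsmul_eq_mul]
    exact mul_inv_cancel₀ (Nat.cast_ne_zero.2 hne.card_pos.ne')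
  intro p hp y₁ y₂ h₁ h₂
  obtain ⟨e, he, rfl⟩ := Finset.mem_image.1 hp
  rw [hone e he y₁ h₁, hone e he y₂ h₂]

end Lumping

/-! ### Wide blocks: neither an e-family nor the dimensional criterion -/

section WideBlock

variable {Y X : Type*} [Fintype Y] [DecidableEq Y] [DecidableEq X]

/-- Three states lumped into `{y₀}` and `{y₁, y₂}`, where both states of the second block have an
edge to `y₀` and to the second block, and `y₁` has an edge to both states of the second block. -/
structure IsWideBlock (κ : Y → X) (E : Finset (Y × Y)) (y₀ y₁ y₂ : Y) : Prop where
  univ_eq : (Finset.univ : Finset Y) = {y₀, y₁, y₂}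
  ne₀₁ : y₀ ≠ y₁
  ne₀₂ : y₀ ≠ y₂
  ne₁₂ : y₁ ≠ y₂
  map_ne : κ y₁ ≠ κ y₀
  map_eq : κ y₂ = κ y₁
  mem₁₀ : (y₁, y₀) ∈ E
  mem₁₁ : (y₁, y₁) ∈ E
  mem₁₂ : (y₁, y₂) ∈ E
  mem₂₀ : (y₂, y₀) ∈ E
  mem₂ : (y₂, y₁) ∈ E ∨ (y₂, y₂) ∈ E

namespace IsWideBlock

variable {κ : Y → X} {E : Finset (Y × Y)} {y₀ y₁ y₂ : Y}

/-- The weight that `y₂` gives to the block `{y₁, y₂}`, for log-weights `r` and `s`. -/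
def rowSum (E : Finset (Y × Y)) (y₁ y₂ : Y) (r s : ℝ) : ℝ :=
  (if (y₂, y₁) ∈ E then Real.exp r else 0) + if (y₂, y₂) ∈ E then Real.exp s else 0

/-- Restriction of a matrix to the edge set. -/
def restrict (E : Finset (Y × Y)) : Matrix Y Y ℝ →ₗ[ℝ] (E → ℝ) where
  toFun φ e := φ e.1.1 e.1.2
  map_add' _ _ := rfl
  map_smul' _ _ := rfl

omit [Fintype Y] [DecidableEq Y] in
theorem restrict_apply (φ : Matrix Y Y ℝ) (e : E) : restrict E φ e = φ e.1.1 e.1.2 := rfl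

omit [Fintype Y] in
theorem rowSum_add (r s t : ℝ) :
    rowSum E y₁ y₂ (r + t) (s + t) = rowSum E y₁ y₂ r s * Real.exp t := by
  simp only [rowSum, Real.exp_add, add_mul, ite_mul, zero_mul]

omit [DecidableEq X] in
theorem rowSum_pos (h : IsWideBlock κ E y₀ y₁ y₂) (r s : ℝ) : 0 < rowSum E y₁ y₂ r s := by
  rcases h.mem₂ with h | h
  · simp only [rowSum, if_pos h]
    split_ifs <;> positivity
  · simp only [rowSum, if_pos h]
    split_ifs <;> positivity

theorem filter₀ (h : IsWideBlock κ E y₀ y₁ y₂) :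
    (Finset.univ.filter fun y => κ y = κ y₀) = {y₀} := by
  rw [h.univ_eq]
  ext y
  simp only [Finset.mem_filter, Finset.mem_insert, Finset.mem_singleton]
  constructor
  · rintro ⟨rfl | rfl | rfl, hy⟩
    · rfl
    · exact absurd hy h.map_ne
    · exact absurd (h.map_eq ▸ hy) h.map_ne
  · rintro rfl
    simp

theorem filter₁ (h : IsWideBlock κ E y₀ y₁ y₂) :
    (Finset.univ.filter fun y => κ y = κ y₁) = {y₁, y₂} := by
  rw [h.univ_eq]
  ext y
  simp only [Finset.mem_filter, Finset.mem_insert, Finset.mem_singleton]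
  constructor
  · rintro ⟨rfl | h' | h', hy⟩
    · exact absurd hy.symm h.map_ne
    · exact .inl h'
    · exact .inr h'
  · rintro (rfl | rfl)
    · simp
    · simp [h.map_eq]

/-- Splits membership in `G_κ` into one linear and one exponential equation. Log-weights are full
matrices whose entries off `E` are discarded, and `rowSum` absorbs the possible absence of an edge
in row `y₂`. -/
theorem restrict_mem_iff (h : IsWideBlock κ E y₀ y₁ y₂) (φ : Matrix Y Y ℝ) :
    restrict E φ ∈ logLumpableCone κ E ↔ φ y₁ y₀ = φ y₂ y₀ ∧
      Real.exp (φ y₁ y₁) + Real.exp (φ y₁ y₂) = rowSum E y₁ y₂ (φ y₂ y₁) (φ y₂ y₂) := by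
  have hM : ∀ F : E → ℝ, (∀ e, 0 < F e) → (∀ e, restrict E φ e = Real.log (F e)) → ∀ y y',
      edgeMatrix F y y' = if (y, y') ∈ E then Real.exp (φ y y') else 0 := by
    intro F hF hl y y'
    split_ifs with he
    · have : φ y y' = Real.log (F ⟨(y, y'), he⟩) := hl ⟨(y, y'), he⟩
      rw [edgeMatrix_of_mem F he, this, Real.exp_log (hF _)]
    · exact edgeMatrix_of_notMem F he
  constructor
  · rintro ⟨F, hF, hb, hl⟩
    have hB := isBlockConstant_edgeMatrix hb
    have h₀ := hB (κ y₀) y₁ y₂ h.map_eq.symm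
    have h₁ := hB (κ y₁) y₁ y₂ h.map_eq.symm
    rw [h.filter₀, Finset.sum_singleton, Finset.sum_singleton, hM F hF hl, hM F hF hl,
      if_pos h.mem₁₀, if_pos h.mem₂₀] at h₀
    rw [h.filter₁, Finset.sum_pair h.ne₁₂, Finset.sum_pair h.ne₁₂, hM F hF hl, hM F hF hl,
      hM F hF hl, hM F hF hl, if_pos h.mem₁₁, if_pos h.mem₁₂] at h₁
    exact ⟨Real.exp_injective h₀, h₁⟩
  · rintro ⟨h₀, h₁⟩
    refine ⟨fun e => Real.exp (restrict E φ e), fun e => Real.exp_pos _, ?_, fun e => by simp⟩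
    have hM' := hM _ (fun e => Real.exp_pos (restrict E φ e)) (fun e => by simp)
    have key : ∀ x', ∑ y' with κ y' = x',
        edgeMatrix (fun e => Real.exp (restrict E φ e)) y₁ y' = ∑ y' with κ y' = x',
        edgeMatrix (fun e => Real.exp (restrict E φ e)) y₂ y' := by
      intro x'
      by_cases hx₀ : x' = κ y₀
      · rw [hx₀, h.filter₀, Finset.sum_singleton, Finset.sum_singleton, hM', hM',
          if_pos h.mem₁₀, if_pos h.mem₂₀, h₀]
      by_cases hx₁ : x' = κ y₁
      · rw [hx₁, h.filter₁, Finset.sum_pair h.ne₁₂, Finset.sum_pair h.ne₁₂, hM', hM', hM', hM',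
          if_pos h.mem₁₁, if_pos h.mem₁₂]
        exact h₁
      · have hempty : (Finset.univ.filter fun y => κ y = x') = ∅ := by
          rw [h.univ_eq]
          ext y
          simp only [Finset.mem_filter, Finset.mem_insert, Finset.mem_singleton,
            Finset.notMem_empty, iff_false]
          rintro ⟨rfl | rfl | rfl, hy⟩
          · exact hx₀ hy.symm
          · exact hx₁ hy.symm
          · exact hx₁ (hy.symm.trans h.map_eq)
        rw [hempty, Finset.sum_empty, Finset.sum_empty]
    intro p _ a b ha hb
    have hab : κ a = κ b := ha.trans hb.symm
    have hcov : ∀ y, y = y₀ ∨ y = y₁ ∨ y = y₂ := fun y => by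
      have := Finset.mem_univ y
      rw [h.univ_eq] at this
      simpa using this
    rcases hcov a with rfl | rfl | rfl <;> rcases hcov b with rfl | rfl | rfl
    · rfl
    · exact absurd hab.symm h.map_ne
    · exact absurd (hab.trans h.map_eq).symm h.map_ne
    · exact absurd hab h.map_ne
    · rfl
    · exact key _
    · exact absurd (h.map_eq.symm.trans hab) h.map_ne
    · exact (key _).symm
    · rfl

/-- The log-weights equal to `a`, `b`, `r`, `s` inside the block `{y₁, y₂}` and zero elsewhere. -/
def blockWeight (y₁ y₂ : Y) (a b r s : ℝ) : Matrix Y Y ℝ := fun y y' =>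
  if y = y₁ then if y' = y₁ then a else if y' = y₂ then b else 0
  else if y = y₂ then if y' = y₁ then r else if y' = y₂ then s else 0
  else 0

theorem restrict_blockWeight_mem_iff (h : IsWideBlock κ E y₀ y₁ y₂) (a b r s : ℝ) :
    restrict E (blockWeight y₁ y₂ a b r s) ∈ logLumpableCone κ E ↔
      Real.exp a + Real.exp b = rowSum E y₁ y₂ r s := by
  rw [h.restrict_mem_iff]
  simp [blockWeight, h.ne₀₁, h.ne₀₂, h.ne₁₂.symm]

/-- Working modulo `N` gains nothing here: the edges into `y₀` force `f y₁ = f y₂`, so the shift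
multiplies both sides of the exponential equation by the same factor. -/
theorem blockWeight_mem_sup_antiShift (h : IsWideBlock κ E y₀ y₁ y₂) {a b r s : ℝ}
    (hg : ∃ g ∈ logLumpableCone κ E, restrict E (blockWeight y₁ y₂ a b r s) - g ∈ antiShift E) :
    Real.exp a + Real.exp b = rowSum E y₁ y₂ r s := by
  obtain ⟨g, hg, c, f, hf⟩ := hg
  have hgφ : g = restrict E (Matrix.of fun y y' =>
      blockWeight y₁ y₂ a b r s y y' - (f y' - f y + c)) := by
    ext e
    have := hf e
    simp only [Pi.sub_apply, restrict_apply, Matrix.of_apply] at this ⊢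
    linarith
  rw [hgφ, h.restrict_mem_iff] at hg
  obtain ⟨h₀, h₁⟩ := hg
  simp only [Matrix.of_apply, blockWeight, h.ne₀₁, h.ne₀₂, h.ne₁₂.symm, if_true, if_false] at h₀ h₁
  have hf₁₂ : f y₁ = f y₂ := by linarith
  rw [hf₁₂] at h₁
  simp only [sub_self, zero_add, sub_eq_add_neg r, sub_eq_add_neg s, rowSum_add, sub_eq_add_neg a,
    sub_eq_add_neg b, Real.exp_add] at h₁
  rw [← add_mul] at h₁
  exact mul_right_cancel₀ (Real.exp_pos _).ne' h₁

/-- The weights `(m/3, 2m/3)` and `(2m/3, m/3)` on the two edges from `y₁` into its block are both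
lumpable. Log-affine extrapolation to parameter `2` yields `(4m/3, m/6)`, whose sum is `3m/2` and
not `m`. -/
theorem not_isEFamily [Fintype X] (h : IsWideBlock κ E y₀ y₁ y₂) (hκ : Function.Surjective κ)
    (hE : StronglyConnected E) : ¬ IsEFamily E (lumpableFamily κ E) := by
  intro hV
  have : Nonempty Y := ⟨y₀⟩
  set m := rowSum E y₁ y₂ 0 0 with hm
  have hm0 : 0 < m := h.rowSum_pos 0 0
  have hmem : ∀ a b : ℝ, Real.exp a + Real.exp b = m →
      expNormalization (restrict E (blockWeight y₁ y₂ a b 0 0)) ∈ lumpableFamily κ E :=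
    fun a b hab => expNormalization_mem_of_mem_logLumpableCone hκ hE
      ((h.restrict_blockWeight_mem_iff a b 0 0).2 hab)
  have e₁ : Real.exp (Real.log (m / 3)) = m / 3 := Real.exp_log (by positivity)
  have e₂ : Real.exp (Real.log (2 * m / 3)) = 2 * m / 3 := Real.exp_log (by positivity)
  have hp := hmem (Real.log (m / 3)) (Real.log (2 * m / 3)) (by rw [e₁, e₂]; ring)
  have hq := hmem (Real.log (2 * m / 3)) (Real.log (m / 3)) (by rw [e₁, e₂]; ring)
  have hpq := hV.affine hE hp hq 2
  have hcomb : restrict E (blockWeight y₁ y₂ (Real.log (m / 3)) (Real.log (2 * m / 3)) 0 0) +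
      (2 : ℝ) • (restrict E (blockWeight y₁ y₂ (Real.log (2 * m / 3)) (Real.log (m / 3)) 0 0) -
        restrict E (blockWeight y₁ y₂ (Real.log (m / 3)) (Real.log (2 * m / 3)) 0 0)) =
      restrict E (blockWeight y₁ y₂ (2 * Real.log (2 * m / 3) - Real.log (m / 3))
        (2 * Real.log (m / 3) - Real.log (2 * m / 3)) 0 0) := by
    rw [← map_sub, ← map_smul, ← map_add]
    congr 1
    ext y y'
    simp only [blockWeight, Matrix.add_apply, Matrix.smul_apply, Matrix.sub_apply, smul_eq_mul]
    split_ifs <;> ring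
  rw [hcomb, expNormalization_mem_lumpableFamily_iff hκ hE] at hpq
  have := h.blockWeight_mem_sup_antiShift hpq
  rw [← hm, Real.exp_sub, Real.exp_sub, two_mul (Real.log _), two_mul (Real.log _), Real.exp_add,
    Real.exp_add, e₁, e₂] at this
  field_simp at this
  norm_num at this

/-- Inverts a symmetric two-by-two system whose determinant is nonzero because `2/3 * 4/3 < 1`. The
factors `2/3` and `4/3` add up to two, so applying them to two equal weights preserves their sum. -/
theorem mem_of_log_combination {V : Type*} [AddCommGroup V] [Module ℝ V] {S : Submodule ℝ V}
    {x y : V} (h₁ : Real.log (2 / 3) • x + Real.log (4 / 3) • y ∈ S)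
    (h₂ : Real.log (4 / 3) • x + Real.log (2 / 3) • y ∈ S) : x ∈ S ∧ y ∈ S := by
  have hlt : Real.log (2 / 3) < 0 := Real.log_neg (by norm_num) (by norm_num)
  have hgt : 0 < Real.log (4 / 3) := Real.log_pos (by norm_num)
  have hsum : Real.log (2 / 3) + Real.log (4 / 3) < 0 := by
    rw [← Real.log_mul (by norm_num) (by norm_num)]
    exact Real.log_neg (by norm_num) (by norm_num)
  have hdet : Real.log (4 / 3) * Real.log (4 / 3) - Real.log (2 / 3) * Real.log (2 / 3) ≠ 0 := by
    have := mul_neg_of_pos_of_neg (sub_pos.2 (hlt.trans hgt)) hsum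
    nlinarith
  constructor
  · refine (S.smul_mem_iff hdet).1 ?_
    convert sub_mem (S.smul_mem (Real.log (4 / 3)) h₂) (S.smul_mem (Real.log (2 / 3)) h₁) using 1
    module
  · refine (S.smul_mem_iff hdet).1 ?_
    convert sub_mem (S.smul_mem (Real.log (4 / 3)) h₁) (S.smul_mem (Real.log (2 / 3)) h₂) using 1
    module

/-- Differences of points of the curved set `G_κ` give every elementary direction except a
separation of the two edges into `y₀`, which `N` supplies. Pulling back to matrices puts the entries
off `E` in `T` for free. -/
theorem span_sup_antiShift_eq_top (h : IsWideBlock κ E y₀ y₁ y₂) :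
    Submodule.span ℝ (logLumpableCone κ E) ⊔ antiShift E = ⊤ := by
  set S := Submodule.span ℝ (logLumpableCone κ E) ⊔ antiShift E with hS
  set T := S.comap (restrict E) with hT
  have hcone : ∀ φ : Matrix Y Y ℝ, φ y₁ y₀ = φ y₂ y₀ →
      Real.exp (φ y₁ y₁) + Real.exp (φ y₁ y₂) = rowSum E y₁ y₂ (φ y₂ y₁) (φ y₂ y₂) → φ ∈ T :=
    fun φ h₁ h₂ => Submodule.mem_sup_left (Submodule.subset_span
      ((h.restrict_mem_iff φ).2 ⟨h₁, h₂⟩))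
  have hnot : ∀ y y', (y, y') ∉ E → Matrix.single y y' (1 : ℝ) ∈ T := by
    intro y y' hy
    have : restrict E (Matrix.single y y' (1 : ℝ)) = 0 := by
      ext e
      refine Matrix.single_apply_of_ne _ _ _ _ _ ?_
      rintro ⟨rfl, rfl⟩
      exact hy e.2
    rw [hT, Submodule.mem_comap, this]
    exact zero_mem _
  set m := rowSum E y₁ y₂ 0 0 with hm
  have hm0 : 0 < m := h.rowSum_pos 0 0
  have e₂ : Real.exp (Real.log (m / 2)) = m / 2 := Real.exp_log (by positivity)
  have e₃ : Real.exp (Real.log (2 / 3)) = 2 / 3 := Real.exp_log (by norm_num)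
  have e₄ : Real.exp (Real.log (4 / 3)) = 4 / 3 := Real.exp_log (by norm_num)
  have n₀₁ := h.ne₀₁
  have n₀₂ := h.ne₀₂
  have n₁₂ := h.ne₁₂
  -- The base point: row `y₂` has unit weights, of sum `m` in the block, and row `y₁` splits `m`
  -- evenly.
  set β := blockWeight y₁ y₂ (Real.log (m / 2)) (Real.log (m / 2)) 0 0 with hβdef
  have hβ₁₀ : β y₁ y₀ = 0 := by simp [hβdef, blockWeight, n₀₁, n₀₂]
  have hβ₂₀ : β y₂ y₀ = 0 := by simp [hβdef, blockWeight, n₀₁, n₀₂]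
  have hβ₁₁ : β y₁ y₁ = Real.log (m / 2) := by simp [hβdef, blockWeight]
  have hβ₁₂ : β y₁ y₂ = Real.log (m / 2) := by simp [hβdef, blockWeight, n₁₂.symm]
  have hβ₂₁ : β y₂ y₁ = 0 := by simp [hβdef, blockWeight, n₁₂.symm]
  have hβ₂₂ : β y₂ y₂ = 0 := by simp [hβdef, blockWeight, n₁₂.symm]
  -- a direction is in `T` when moving `β` along it preserves lumpability
  have hdir : ∀ δ : Matrix Y Y ℝ, δ y₁ y₀ = δ y₂ y₀ →
      m / 2 * Real.exp (δ y₁ y₁) + m / 2 * Real.exp (δ y₁ y₂) =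
        rowSum E y₁ y₂ (δ y₂ y₁) (δ y₂ y₂) → δ ∈ T := by
    intro δ h₁ h₂
    have hβ : β ∈ T := hcone β (by rw [hβ₁₀, hβ₂₀]) (by
      rw [hβ₁₁, hβ₁₂, hβ₂₁, hβ₂₂, e₂, ← hm]; ring)
    have hβδ : β + δ ∈ T := hcone _
      (by simp only [Matrix.add_apply, hβ₁₀, hβ₂₀, h₁])
      (by simp only [Matrix.add_apply, hβ₁₁, hβ₁₂, hβ₂₁, hβ₂₂, Real.exp_add, e₂, zero_add, h₂])
    simpa using sub_mem hβδ hβ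
  have h0 : ∀ y', Matrix.single y₀ y' (1 : ℝ) ∈ T := fun y' => by
    refine hdir _ ?_ ?_
    · simp [n₀₁, n₀₂]
    · simp [n₀₁, n₀₂, ← hm]
  have hw : ∀ a b r s : ℝ, m / 2 * Real.exp a + m / 2 * Real.exp b = rowSum E y₁ y₂ r s →
      a • Matrix.single y₁ y₁ (1 : ℝ) + b • Matrix.single y₁ y₂ (1 : ℝ) +
        r • Matrix.single y₂ y₁ (1 : ℝ) + s • Matrix.single y₂ y₂ (1 : ℝ) ∈ T := by
    intro a b r s hab
    refine hdir _ ?_ ?_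
    · simp [n₀₁.symm, n₀₂.symm]
    · simpa [Matrix.single_apply, n₁₂, n₁₂.symm] using hab
  obtain ⟨h11, h12⟩ : Matrix.single y₁ y₁ (1 : ℝ) ∈ T ∧ Matrix.single y₁ y₂ (1 : ℝ) ∈ T := by
    apply mem_of_log_combination
    · simpa only [zero_smul, add_zero] using hw (Real.log (2 / 3)) (Real.log (4 / 3)) 0 0 (by rw [e₃, e₄, ← hm]; ring)
    · simpa only [zero_smul, add_zero] using hw (Real.log (4 / 3)) (Real.log (2 / 3)) 0 0 (by rw [e₃, e₄, ← hm]; ring)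
  obtain ⟨h21, h22⟩ : Matrix.single y₂ y₁ (1 : ℝ) ∈ T ∧ Matrix.single y₂ y₂ (1 : ℝ) ∈ T := by
    have hsum : Matrix.single y₂ y₁ (1 : ℝ) + Matrix.single y₂ y₂ (1 : ℝ) ∈ T := by
      -- Raising all four log-weights by one multiplies both block sums by `exp 1`.
      have := hw 1 1 1 1 (by
        have := rowSum_add (E := E) (y₁ := y₁) (y₂ := y₂) 0 0 1
        rw [zero_add, ← hm] at this
        rw [this]; ring)
      simp only [one_smul] at this
      convert sub_mem (sub_mem this h11) h12 using 1
      abel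
    -- With both edges present, row `y₂` can be perturbed as row `y₁` was; otherwise the missing
    -- edge's direction lies in `T` trivially and `hsum` gives the other.
    by_cases h₁ : (y₂, y₁) ∈ E
    · by_cases h₂ : (y₂, y₂) ∈ E
      · have hrs : ∀ r s, rowSum E y₁ y₂ r s = Real.exp r + Real.exp s := fun r s => by
          simp [rowSum, h₁, h₂]
        have hm2 : m = 2 := by rw [hm, hrs]; norm_num
        apply mem_of_log_combination
        · simpa only [zero_smul, zero_add] using hw 0 0 (Real.log (2 / 3)) (Real.log (4 / 3))
            (by rw [hrs, e₃, e₄, hm2]; norm_num)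
        · simpa only [zero_smul, zero_add] using hw 0 0 (Real.log (4 / 3)) (Real.log (2 / 3))
            (by rw [hrs, e₃, e₄, hm2]; norm_num)
      · exact ⟨by simpa using sub_mem hsum (hnot _ _ h₂), hnot _ _ h₂⟩
    · exact ⟨hnot _ _ h₁, by simpa using sub_mem hsum (hnot _ _ h₁)⟩
  have hsum0 : Matrix.single y₁ y₀ (1 : ℝ) + Matrix.single y₂ y₀ (1 : ℝ) ∈ T := by
    refine hdir _ ?_ ?_
    · simp [n₁₂, n₁₂.symm]
    · simp [n₀₁, n₀₂, ← hm]
  -- Elements of the span agree on the two edges into `y₀`. The difference of potentials of the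
  -- indicator of `y₁` breaks this tie.
  have hN : Matrix.single y₀ y₁ (1 : ℝ) + Matrix.single y₂ y₁ (1 : ℝ) -
      Matrix.single y₁ y₀ (1 : ℝ) - Matrix.single y₁ y₂ (1 : ℝ) ∈ T := by
    refine Submodule.mem_sup_right ⟨0, Pi.single y₁ 1, fun e => ?_⟩
    have hcov : ∀ y, y = y₀ ∨ y = y₁ ∨ y = y₂ := fun y => by
      have := Finset.mem_univ y
      rw [h.univ_eq] at this
      simpa using this
    simp only [restrict_apply, Matrix.sub_apply, Matrix.add_apply]
    rcases hcov e.1.1 with h₁ | h₁ | h₁ <;> rcases hcov e.1.2 with h₂ | h₂ | h₂ <;>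
      simp [h₁, h₂, n₀₁, n₀₂, n₁₂, n₀₁.symm, n₀₂.symm,
        n₁₂.symm]
  have h10 : Matrix.single y₁ y₀ (1 : ℝ) ∈ T := by
    convert sub_mem (sub_mem (add_mem (h0 y₁) h21) h12) hN using 1
    abel
  have h20 : Matrix.single y₂ y₀ (1 : ℝ) ∈ T := by
    simpa using sub_mem hsum0 h10
  have hall : ∀ y y', Matrix.single y y' (1 : ℝ) ∈ T := by
    intro y y'
    have hy := Finset.mem_univ y
    have hy' := Finset.mem_univ y'
    rw [h.univ_eq] at hy hy'
    simp only [Finset.mem_insert, Finset.mem_singleton] at hy hy'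
    rcases hy with rfl | rfl | rfl
    · exact h0 y'
    · rcases hy' with rfl | rfl | rfl <;> assumption
    · rcases hy' with rfl | rfl | rfl <;> assumption
  rw [eq_top_iff]
  intro g _
  have hg : g = restrict E (edgeMatrix g) := by
    ext e
    exact (edgeMatrix_of_mem g e.2).symm
  have : edgeMatrix g ∈ T := by
    rw [Matrix.matrix_eq_sum_single (edgeMatrix g)]
    refine Submodule.sum_mem _ fun y _ => Submodule.sum_mem _ fun y' _ => ?_
    have := T.smul_mem (edgeMatrix g y y') (hall y y')
    rwa [Matrix.smul_single, smul_eq_mul, mul_one] at this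
  rw [hg]
  exact this

/-- The left side is `|E|`. Exactly two lumped edges leave the two-state block, so the sum is `|D| +
2` and the right side is `|E| + 3 + |D| - 2 - (|D| + 2) = |E| - 1`. -/
theorem not_dimensionalCriterion [Fintype X] (h : IsWideBlock κ E y₀ y₁ y₂)
    (hκ : Function.Surjective κ) : ¬ DimensionalCriterion κ E := by
  have hY : Fintype.card Y = 3 := by
    rw [← Finset.card_univ, h.univ_eq, Finset.card_eq_three]
    exact ⟨_, _, _, h.ne₀₁, h.ne₀₂, h.ne₁₂, rfl⟩
  have huniv : (Finset.univ : Finset X) = {κ y₀, κ y₁} := by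
    rw [← Finset.image_univ_of_surjective hκ, h.univ_eq]
    simp [h.map_eq]
  have hX : Fintype.card X = 2 := by
    rw [← Finset.card_univ, huniv, Finset.card_pair h.map_ne.symm]
  have hcov : ∀ x, x = κ y₀ ∨ x = κ y₁ := fun x => by
    have := Finset.mem_univ x
    rw [huniv] at this
    simpa using this
  have hfiber : ∀ p : X × X, ((Finset.univ.filter fun y => κ y = p.1).card : ℤ) =
      1 + if p.1 = κ y₁ then 1 else 0 := fun p => by
    rcases hcov p.1 with hp | hp
    · rw [hp, h.filter₀, Finset.card_singleton, if_neg h.map_ne.symm]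
      rfl
    · rw [hp, h.filter₁, Finset.card_pair h.ne₁₂, if_pos rfl]
      rfl
  have hfilter : (lumpedEdges κ E).filter (fun p => p.1 = κ y₁) =
      {(κ y₁, κ y₀), (κ y₁, κ y₁)} := by
    ext ⟨x, x'⟩
    simp only [Finset.mem_filter, Finset.mem_insert, Finset.mem_singleton, Prod.mk.injEq]
    constructor
    · rintro ⟨-, hx⟩
      rcases hcov x' with h' | h'
      · exact .inl ⟨hx, h'⟩
      · exact .inr ⟨hx, h'⟩
    · rintro (⟨rfl, rfl⟩ | ⟨rfl, rfl⟩)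
      · exact ⟨Finset.mem_image.2 ⟨_, h.mem₁₀, rfl⟩, rfl⟩
      · exact ⟨Finset.mem_image.2 ⟨_, h.mem₁₁, rfl⟩, rfl⟩
  have hsum : ∑ p ∈ lumpedEdges κ E, ((Finset.univ.filter fun y => κ y = p.1).card : ℤ) =
      (lumpedEdges κ E).card + 2 := by
    simp only [hfiber]
    rw [Finset.sum_add_distrib, Finset.sum_boole, hfilter, Finset.card_pair]
    · simp
    · simp [h.map_ne.symm]
  rw [DimensionalCriterion, h.span_sup_antiShift_eq_top, finrank_top,
    Module.finrank_fintype_fun_eq_card, Fintype.card_coe, hsum, hY, hX]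
  push_cast
  omega

end IsWideBlock

end WideBlock

/-! ### Classification of the graphs on three states -/

section ThreeStates

/-- The condition on lumped edges follows from the others, since `D` is the image of `E`. -/
theorem FamilyEquiv.of_edges {Y₁ X₁ Y₂ X₂ : Type*} [DecidableEq X₁] [DecidableEq X₂]
    {κ₁ : Y₁ → X₁} {E₁ : Finset (Y₁ × Y₁)} {κ₂ : Y₂ → X₂} {E₂ : Finset (Y₂ × Y₂)}
    (φ : Y₁ ≃ Y₂) (ψ : X₁ ≃ X₂) (hE : ∀ y y', (φ y, φ y') ∈ E₂ ↔ (y, y') ∈ E₁)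
    (hκ : ∀ y, ψ (κ₁ y) = κ₂ (φ y)) : FamilyEquiv κ₁ E₁ κ₂ E₂ := by
  refine ⟨φ, ψ, hE, fun x x' => ?_, hκ⟩
  simp only [lumpedEdges, Finset.mem_image, Prod.exists, Prod.mk.injEq]
  constructor
  · rintro ⟨a, b, hab, h₁, h₂⟩
    refine ⟨φ.symm a, φ.symm b, (hE _ _).1 (by simpa using hab), ψ.injective ?_, ψ.injective ?_⟩
    · rw [hκ, φ.apply_symm_apply, h₁]
    · rw [hκ, φ.apply_symm_apply, h₂]
  · rintro ⟨a, b, hab, rfl, rfl⟩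
    exact ⟨φ a, φ b, (hE _ _).2 hab, (hκ a).symm, (hκ b).symm⟩

theorem exists_edge_of_transGen {α : Type*} {r : α → α → Prop} (p : α → Prop) {a b : α}
    (h : Relation.TransGen r a b) (ha : p a) (hb : ¬ p b) : ∃ c d, r c d ∧ p c ∧ ¬ p d := by
  induction h with
  | @single b hab => exact ⟨a, b, hab, ha, hb⟩
  | @tail b c _ hbc ih =>
    by_cases hpb : p b
    · exact ⟨b, c, hbc, hpb, hb⟩
    · exact ih hpb

/-- The twenty-six patterns. -/
def pattern : Fin 12 ⊕ Fin 14 → Finset (Fin 3 × Fin 3) := Sum.elim listedPattern otherPattern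

theorem exists_perm_threeLump : ∀ f : Fin 3 → Fin 2, Function.Surjective f →
    ∃ (σ : Equiv.Perm (Fin 3)) (τ : Equiv.Perm (Fin 2)), ∀ i, τ (f i) = threeLump (σ i) := by
  decide +kernel

/-- The first six conditions give each proper nonempty set of states an outgoing edge, which is
strong connectivity. The last two say that states `1` and `2` reach the same blocks. The only
remaining relabeling is the swap of `1` and `2`, applied when `s` is false. -/
theorem exists_pattern_of_bits : ∀ b₀₀ b₀₁ b₀₂ b₁₀ b₁₁ b₁₂ b₂₀ b₂₁ b₂₂ : Bool,
    b₀₁ || b₀₂ → b₁₀ || b₁₂ → b₂₀ || b₂₁ → b₀₂ || b₁₂ → b₀₁ || b₂₁ → b₁₀ || b₂₀ →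
    b₁₀ = b₂₀ → (b₁₁ || b₁₂) = (b₂₁ || b₂₂) →
    ∃ a, ∃ s : Bool, ∀ i j,
      (if s then (i, j) else (Equiv.swap 1 2 i, Equiv.swap 1 2 j)) ∈ pattern a ↔
        ![![b₀₀, b₀₁, b₀₂], ![b₁₀, b₁₁, b₁₂], ![b₂₀, b₂₁, b₂₂]] i j = true := by
  decide +kernel

theorem pattern_injective : ∀ (φ : Equiv.Perm (Fin 3)) (ψ : Equiv.Perm (Fin 2)),
    (∀ y, ψ (threeLump y) = threeLump (φ y)) → ∀ a b : Fin 12 ⊕ Fin 14,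
    (∀ y y', (φ y, φ y') ∈ pattern b ↔ (y, y') ∈ pattern a) → a = b := by
  decide +kernel

/-- A decidable form of strong connectivity: walks of one to three edges, the shorter ones coded by
repeated vertices. -/
theorem pattern_connected : ∀ (a : Fin 12 ⊕ Fin 14) (i j : Fin 3),
    ∃ k l, ((i, k) ∈ pattern a ∧ (k = l ∨ (k, l) ∈ pattern a) ∧ (l = j ∨ (l, j) ∈ pattern a)) := by
  decide +kernel

theorem pattern_uniform : ∀ a : Fin 12 ⊕ Fin 14, ∀ e ∈ pattern a, ∀ y,
    threeLump y = threeLump e.1 → ∃ y', threeLump y' = threeLump e.2 ∧ (y, y') ∈ pattern a := by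
  decide +kernel

theorem listedPattern_hasSingleEdges : ∀ i, HasSingleEdges threeLump (listedPattern i) := by
  unfold HasSingleEdges
  decide +kernel

theorem otherPattern_edges : ∀ j, (1, 0) ∈ otherPattern j ∧ (1, 1) ∈ otherPattern j ∧
    (1, 2) ∈ otherPattern j ∧ (2, 0) ∈ otherPattern j ∧
    ((2, 1) ∈ otherPattern j ∨ (2, 2) ∈ otherPattern j) := by
  decide +kernel

theorem threeLump_surjective : Function.Surjective threeLump := by
  decide +kernel

theorem pattern_stronglyConnected (a : Fin 12 ⊕ Fin 14) : StronglyConnected (pattern a) := by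
  intro i j
  obtain ⟨k, l, h₁, h₂, h₃⟩ := pattern_connected a i j
  have h₁' : Relation.TransGen (fun a' b => (a', b) ∈ pattern a) i k := .single h₁
  have h₂' : Relation.TransGen (fun a' b => (a', b) ∈ pattern a) i l := by
    rcases h₂ with rfl | h₂
    · exact h₁'
    · exact h₁'.tail h₂
  rcases h₃ with rfl | h₃
  · exact h₂'
  · exact h₂'.tail h₃

variable {Y X : Type*} {κ : Y → X} {E : Finset (Y × Y)}

theorem hasSingleEdges_of_familyEquiv [DecidableEq X] {i : Fin 12}
    (h : FamilyEquiv κ E threeLump (listedPattern i)) : HasSingleEdges κ E := by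
  obtain ⟨φ, ψ, hE, -, hκ⟩ := h
  intro y₁ y₂ hne h₁₂ y y' h hy hy'
  refine φ.injective (listedPattern_hasSingleEdges i (φ y₁) (φ y₂) (φ.injective.ne hne) ?_ _ _ ?_
    ((hE _ _).2 hy) ((hE _ _).2 hy'))
  · rw [← hκ, ← hκ, h₁₂]
  · rw [← hκ, ← hκ, h]

theorem exists_isWideBlock_of_familyEquiv [Fintype Y] [DecidableEq Y] [DecidableEq X] {j : Fin 14}
    (h : FamilyEquiv κ E threeLump (otherPattern j)) :
    ∃ y₀ y₁ y₂, IsWideBlock κ E y₀ y₁ y₂ := by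
  obtain ⟨φ, ψ, hE, -, hκ⟩ := h
  have hmem : ∀ a b, (a, b) ∈ otherPattern j ↔ (φ.symm a, φ.symm b) ∈ E := fun a b => by
    rw [← hE, φ.apply_symm_apply, φ.apply_symm_apply]
  have hk : ∀ a, ψ (κ (φ.symm a)) = threeLump a := fun a => by rw [hκ, φ.apply_symm_apply]
  obtain ⟨h₁₀, h₁₁, h₁₂, h₂₀, h₂⟩ := otherPattern_edges j
  simp only [hmem] at h₁₀ h₁₁ h₁₂ h₂₀ h₂
  refine ⟨φ.symm 0, φ.symm 1, φ.symm 2, ?_, φ.symm.injective.ne (by decide),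
    φ.symm.injective.ne (by decide), φ.symm.injective.ne (by decide), fun h => ?_,
    ψ.injective ?_, h₁₀, h₁₁, h₁₂, h₂₀, h₂⟩
  · rw [← Finset.image_univ_of_surjective φ.symm.surjective,
      show (Finset.univ : Finset (Fin 3)) = {0, 1, 2} from rfl]
    simp
  · have := congrArg ψ h
    rw [hk, hk] at this
    revert this
    decide
  · rw [hk, hk]
    decide

theorem exists_equiv_threeLump [Fintype Y] [Fintype X] (hY : Fintype.card Y = 3) (hκ : Function.Surjective κ)
    (hd : ¬ IsDegenerate κ) :
    ∃ (φ : Y ≃ Fin 3) (ψ : X ≃ Fin 2), ∀ y, ψ (κ y) = threeLump (φ y) := by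
  have hX : Fintype.card X = 2 := by
    have : Nonempty Y := Fintype.card_pos_iff.1 (by omega)
    have : Nonempty X := this.map κ
    have h₁ := Fintype.card_le_of_surjective κ hκ
    have h₂ : 0 < Fintype.card X := Fintype.card_pos
    simp only [IsDegenerate, not_or, hY] at hd
    omega
  let φ := Fintype.equivFinOfCardEq hY
  let ψ := Fintype.equivFinOfCardEq hX
  obtain ⟨σ, τ, h⟩ := exists_perm_threeLump (ψ ∘ κ ∘ φ.symm)
    (ψ.surjective.comp (hκ.comp φ.symm.surjective))
  exact ⟨φ.trans σ, ψ.trans τ, fun y => by simpa using h (φ y)⟩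

theorem exists_familyEquiv_pattern [Fintype Y] [DecidableEq Y] [Fintype X] [DecidableEq X]
    (hY : Fintype.card Y = 3) (hκ : Function.Surjective κ)
    (hW : (lumpableFamily κ E).Nonempty) (hd : ¬ IsDegenerate κ) :
    ∃ a, FamilyEquiv κ E threeLump (pattern a) := by
  obtain ⟨φ, ψ, hφ⟩ := exists_equiv_threeLump hY hκ hd
  obtain ⟨P, hP⟩ := hW
  have hE := stronglyConnected_of_mem hP.1
  have hc := exists_edge_of_mem_lumpableFamily hκ hP
  let b : Fin 3 → Fin 3 → Bool := fun i j => decide ((φ.symm i, φ.symm j) ∈ E)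
  have hb : ∀ y y', b (φ y) (φ y') = true ↔ (y, y') ∈ E := fun y y' => by simp [b]
  -- Strong connectivity as a cut condition, which becomes a disjunction of adjacency bits for each
  -- concrete `S`.
  have hcut : ∀ S : Fin 3 → Bool, ∀ i j, S i = true → S j = false →
      ∃ k l, b k l = true ∧ S k = true ∧ S l = false := by
    intro S i j hi hj
    obtain ⟨c, d, h₁, h₂, h₃⟩ := exists_edge_of_transGen (fun y => S (φ y) = true)
      (hE (φ.symm i) (φ.symm j)) (by simpa using hi) (by simpa using hj)
    exact ⟨φ c, φ d, (hb _ _).2 h₁, h₂, by simpa using h₃⟩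
  have hblock : ∀ i j k, threeLump i = threeLump k → b i j = true →
      ∃ l, threeLump l = threeLump j ∧ b k l = true := by
    intro i j k hik hij
    have hij' : (φ.symm i, φ.symm j) ∈ E := by simpa [b] using hij
    obtain ⟨y', h₁, h₂⟩ := hc _ hij' (φ.symm k) (ψ.injective (by simp [hφ, hik]))
    refine ⟨φ y', ?_, by simpa [b] using h₂⟩
    rw [← hφ, h₁, hφ, φ.apply_symm_apply]
  obtain ⟨a, s, h⟩ := exists_pattern_of_bits (b 0 0) (b 0 1) (b 0 2) (b 1 0) (b 1 1) (b 1 2)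
    (b 2 0) (b 2 1) (b 2 2)
    (by simpa [Fin.exists_fin_succ] using hcut ![true, false, false] 0 1 rfl rfl)
    (by simpa [Fin.exists_fin_succ] using hcut ![false, true, false] 1 0 rfl rfl)
    (by simpa [Fin.exists_fin_succ] using hcut ![false, false, true] 2 0 rfl rfl)
    (by simpa [Fin.exists_fin_succ] using hcut ![true, true, false] 0 2 rfl rfl)
    (by simpa [Fin.exists_fin_succ] using hcut ![true, false, true] 0 1 rfl rfl)
    (by simpa [Fin.exists_fin_succ] using hcut ![false, true, true] 1 0 rfl rfl)
    (by
      have h₁ := hblock 1 0 2 rfl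
      have h₂ := hblock 2 0 1 rfl
      simp [Fin.exists_fin_succ, threeLump] at h₁ h₂
      exact Bool.eq_iff_iff.2 ⟨h₁, h₂⟩)
    (by
      have h₁ := hblock 1 1 2 rfl
      have h₂ := hblock 1 2 2 rfl
      have h₃ := hblock 2 1 1 rfl
      have h₄ := hblock 2 2 1 rfl
      simp [Fin.exists_fin_succ, threeLump] at h₁ h₂ h₃ h₄
      rw [Bool.eq_iff_iff, Bool.or_eq_true, Bool.or_eq_true]
      exact ⟨fun h => h.elim h₁ h₂, fun h => h.elim h₃ h₄⟩)
  have hb' : ∀ i j, ![![b 0 0, b 0 1, b 0 2], ![b 1 0, b 1 1, b 1 2],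
      ![b 2 0, b 2 1, b 2 2]] i j = b i j := by
    intro i j
    fin_cases i <;> fin_cases j <;> rfl
  simp only [hb'] at h
  refine ⟨a, ?_⟩
  cases s
  · refine .of_edges (φ.trans (Equiv.swap 1 2)) ψ (fun y y' => ?_) fun y => ?_
    · rw [← hb, ← h]
      rfl
    · rw [hφ, Equiv.trans_apply]
      generalize φ y = i
      revert i
      decide
  · exact .of_edges φ ψ (fun y y' => by rw [← hb, ← h]; rfl) hφ

end ThreeStates

end

theorem mainTheorem8 {Y X : Type*} [Fintype Y] [DecidableEq Y] [Fintype X] [DecidableEq X]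
    (hY : Fintype.card Y = 3) (κ : Y → X) (hκ : Function.Surjective κ)
    (E : Finset (Y × Y)) (hW : (lumpableFamily κ E).Nonempty) :
    -- the classification
    (IsEFamily E (lumpableFamily κ E) ↔
      IsDegenerate κ ∨ ∃ i : Fin 12, FamilyEquiv κ E threeLump (listedPattern i)) ∧
    -- the remaining families fall into fourteen classes and fail the dimensional criterion
    (¬ IsDegenerate κ → (¬ ∃ i : Fin 12, FamilyEquiv κ E threeLump (listedPattern i)) →
      (∃ j : Fin 14, FamilyEquiv κ E threeLump (otherPattern j)) ∧
        ¬ DimensionalCriterion κ E) ∧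
    -- the twelve and the fourteen families are non-empty and pairwise inequivalent
    (∀ a : Fin 12 ⊕ Fin 14,
      (lumpableFamily threeLump (Sum.elim listedPattern otherPattern a)).Nonempty) ∧
    (∀ a b : Fin 12 ⊕ Fin 14,
      FamilyEquiv threeLump (Sum.elim listedPattern otherPattern a)
        threeLump (Sum.elim listedPattern otherPattern b) → a = b) := by
  have : Nonempty Y := Fintype.card_pos_iff.1 (by omega)
  obtain ⟨P, hP⟩ := id hW
  have hE := stronglyConnected_of_mem hP.1
  -- Both negative conclusions pass through this: outside the listed patterns only wide blocks
  -- remain.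
  have hother : ¬ IsDegenerate κ →
      (¬ ∃ i : Fin 12, FamilyEquiv κ E threeLump (listedPattern i)) →
      ∃ j : Fin 14, FamilyEquiv κ E threeLump (otherPattern j) := by
    intro hd hl
    obtain ⟨i | j, h⟩ := exists_familyEquiv_pattern hY hκ hW hd
    · exact absurd ⟨i, h⟩ hl
    · exact ⟨j, h⟩
  refine ⟨⟨fun hV => ?_, ?_⟩, fun hd hl => ?_, fun a => ?_, ?_⟩
  · by_contra! hcon
    obtain ⟨j, hj⟩ := hother hcon.1 (not_exists.2 hcon.2)
    obtain ⟨_, _, _, hw⟩ := exists_isWideBlock_of_familyEquiv hj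
    exact hw.not_isEFamily hκ hE hV
  · rintro (hd | ⟨i, hi⟩)
    · exact isEFamily_of_isDegenerate hκ hW hd
    · exact isEFamily_of_hasSingleEdges hκ hW (hasSingleEdges_of_familyEquiv hi)
  · obtain ⟨j, hj⟩ := hother hd hl
    obtain ⟨_, _, _, hw⟩ := exists_isWideBlock_of_familyEquiv hj
    exact ⟨⟨j, hj⟩, hw.not_dimensionalCriterion hκ⟩
  · exact lumpableFamily_nonempty threeLump_surjective (pattern_stronglyConnected a)
      (pattern_uniform a)
  · rintro a b ⟨φ, ψ, h, -, hk⟩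
    exact pattern_injective φ ψ hk a b h
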